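/- Let $N\ge 1$, $0<\rho\le 1$, $T>0$, and let $\mathbb{T}^N=(-\pi,\pi]^N$; functions on $\mathbb{T}^N$ are identified with functions on $\mathbb{R}^N$ that are $2\pi$-periodic in each variable. For $g\in L_2(\mathbb{T}^N)$ put $g_n=(2\pi)^{-N}\int_{\mathbb{T}^N}g(x)e^{-inx}\,dx$, $n\in\mathbb{Z}^N$, and for $a>0$ let $L_2^a(\mathbb{T}^N)$ be the Sobolev space of all $g\in L_2(\mathbb{T}^N)$ with $\sum_{n}(1+|n|^2)^a|g_n|^2<\infty$. Let $A(D)=\sum_{|\alpha|=m}a_\alpha D^\alpha$, $D_j=-i\,\partial/\partial x_j$, $m\ge 1$, be a homogeneous symmetric positive elliptic operator with constant coefficients, i.e. the $a_\alpha$ are real and $A(\xi)=\sum_{|\alpha|=m}a_\alpha\xi^\alpha>0$ for all $\xi\in\mathbb{R}^N\setminus\{0\}$ (so that $A(D)e^{inx}=A(n)e^{inx}$). For $\sigma>0$ put $\hat A^{\sigma}g=\sum_{n}A(n)^{\sigma}g_ne^{inx}$, a series in $L_2(\mathbb{T}^N)$. Let $\partial_t^{\rho-1}g(t)=\frac{1}{\Gamma(1-\rho)}\int_0^t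 (t-s)^{-\rho}g(s)\,ds$ for $\rho<1$, $\partial_t^{0}g=g$, and let $\partial_t^{\rho}g=\frac{d}{dt}\partial_t^{\rho-1}g$ be the Riemann--Liouville derivative (the derivative at $t=T$ being the left one). Consider the problem $$\partial_t^\rho u(x,t)+A(D)u(x,t)=f(x,t),\quad x\in\mathbb{T}^N,\ 0<t\le T;\qquad \lim_{t\to 0+}\partial_t^{\rho-1}u(x,t)=\varphi(x),\quad x\in\mathbb{T}^N. \tag{1}$$ A solution of (1) is a function $u$, $2\pi$-periodic in each $x_j$ and of class $C^m$ in $x$ for each $t\in(0,T]$, such that $\partial_t^{\rho-1}u$ exists and is continuous on $\mathbb{T}^N\times(0,T]$ with a continuous extension to $\mathbb{T}^N\times[0,T]$, such that $\partial_t^\rho u$ and $A(D)u$ exist and are continuous on $\mathbb{T}^N\times(0,T]$, and such that (1) holds at every point. **Theorem.** Let $\tau>\frac N2$ and $\varphi\in L_2^\tau(\mathbb{T}^N)$. Let $f(\cdot,t)\in L_2^\tau(\mathbb{T}^N)$ for every $t\in[0,T]$, let $F(t)=\hat A^{\tau/m}f(\cdot,t)$ be continuous on $[0,T]$ in the norm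 of $L_2(\mathbb{T}^N)$, and let the mean value $f_0(t)=(2\pi)^{-N}\int_{\mathbb{T}^N}f(x,t)\,dx$ be continuous on $[0,T]$. Then $\varphi$ and all $f(\cdot,t)$, $t\in[0,T]$, have continuous $2\pi$-periodic representatives, and, with these representatives as data, problem (1) has a solution. It has the form $$u(x,t)=\sum_{n\in\mathbb{Z}^N}\Big[\varphi_n t^{\rho-1}E_{\rho,\rho}(-A(n)t^\rho)+\int_0^t f_n(t-\xi)\,\xi^{\rho-1}E_{\rho,\rho}(-A(n)\xi^\rho)\,d\xi\Big]e^{inx},$$ where $\varphi_n$ and $f_n(t)$ are the Fourier coefficients of $\varphi$ and $f(\cdot,t)$ and $E_{\rho,\mu}(z)=\sum_{k=0}^\infty \frac{z^k}{\Gamma(\rho k+\mu)}$ is the Mittag-Leffler function, and for each $t\in(0,T]$ this series converges absolutely and uniformly in $x\in\mathbb{T}^N$. -/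

import Mathlib

namespace TorusSubdiffusion

open MeasureTheory Set Filter Topology

noncomputable section

/-- The fundamental cell `(-π, π]^N` of the torus. -/
def cell (N : ℕ) : Set (Fin N → ℝ) := Set.univ.pi fun _ => Set.Ioc (-Real.pi) Real.pi

/-- Lebesgue measure on the fundamental cell. -/
abbrev torusMeasure (N : ℕ) : Measure (Fin N → ℝ) := volume.restrict (cell N)

instance instIsFiniteMeasureTorus (N : ℕ) : IsFiniteMeasure (torusMeasure N) := by
  refine ⟨?_⟩
  rw [Measure.restrict_apply_univ, cell, Real.volume_pi_Ioc]
  exact ENNReal.prod_lt_top fun i _ => ENNReal.ofReal_lt_top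

/-- The complex Hilbert space `L_2(𝕋^N)`. -/
abbrev L2T (N : ℕ) := Lp ℂ 2 (torusMeasure N)

/-- Functions on `ℝ^N` that are `2π`-periodic in each variable. -/
def IsPeriodic {N : ℕ} (g : (Fin N → ℝ) → ℂ) : Prop :=
  ∀ (j : Fin N) (x : Fin N → ℝ), g (x + Pi.single j (2 * Real.pi)) = g x

/-- The exponential `x ↦ e^{i n x}`. -/
def expFun {N : ℕ} (n : Fin N → ℤ) (x : Fin N → ℝ) : ℂ :=
  Complex.exp (Complex.I * ((∑ j, (n j : ℝ) * x j : ℝ) : ℂ))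

theorem memLp_expFun {N : ℕ} (n : Fin N → ℤ) : MemLp (expFun n) 2 (torusMeasure N) := by
  refine MemLp.of_bound (Continuous.aestronglyMeasurable ?_) 1 (Eventually.of_forall fun x => ?_)
  · unfold expFun; fun_prop
  · rw [expFun, mul_comm, Complex.norm_exp_ofReal_mul_I]

/-- The exponential `e^{i n x}` as an element of `L_2(𝕋^N)`. -/
def expL2 {N : ℕ} (n : Fin N → ℤ) : L2T N := (memLp_expFun n).toLp (expFun n)

/-- The Fourier coefficient `g_n = (2π)^{-N} ∫ g(x) e^{-i n x} dx`, so that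
`g = ∑ g_n e^{i n x}`. -/
def coeff {N : ℕ} (g : L2T N) (n : Fin N → ℤ) : ℂ :=
  (((2 * Real.pi) ^ N : ℝ) : ℂ)⁻¹ * ∫ x, g x * expFun (-n) x ∂(torusMeasure N)

/-- Membership in the Sobolev (Liouville) space `L_2^a(𝕋^N)`. -/
def MemSobolev {N : ℕ} (a : ℝ) (g : L2T N) : Prop :=
  Summable fun n : Fin N → ℤ => (1 + ∑ j, (n j : ℝ) ^ 2) ^ a * ‖coeff g n‖ ^ 2

/-- `A(ξ) = ∑_{|α| = m} a_α ξ^α` is the symbol of a homogeneous symmetric positive elliptic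
operator `A(D)` of order `m` with constant coefficients, where `D_j = -i ∂/∂x_j`. Formal symmetry
of `A(D)` says that the `a_α` are real, and positivity `(A(D) g, g) ≥ 0` follows from ellipticity
`A(ξ) > 0`, `ξ ≠ 0`. -/
structure IsEllipticSymbol {N : ℕ} (A : MvPolynomial (Fin N) ℝ) (m : ℕ) : Prop where
  order_pos : 0 < m
  homogeneous : A.IsHomogeneous m
  elliptic : ∀ ξ : Fin N → ℝ, ξ ≠ 0 → 0 < MvPolynomial.eval ξ A

/-- The value `A(n)` of the symbol at a lattice point. -/
def symbolAt {N : ℕ} (A : MvPolynomial (Fin N) ℝ) (n : Fin N → ℤ) : ℝ :=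
  MvPolynomial.eval (fun j => (n j : ℝ)) A

/-- `D_j = -i ∂/∂x_j`. -/
def partialD {N : ℕ} (j : Fin N) (g : (Fin N → ℝ) → ℂ) : (Fin N → ℝ) → ℂ :=
  fun x => -Complex.I * fderiv ℝ g x (Pi.single j 1)

/-- `D^α = D_1^{α_1} ⋯ D_N^{α_N}`. -/
def multiD {N : ℕ} (α : Fin N →₀ ℕ) (g : (Fin N → ℝ) → ℂ) : (Fin N → ℝ) → ℂ :=
  (List.finRange N).foldr (fun j h => (partialD j)^[α j] h) g

/-- The differential operator `A(D) = ∑_α a_α D^α`. -/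
def diffOp {N : ℕ} (A : MvPolynomial (Fin N) ℝ) (g : (Fin N → ℝ) → ℂ) (x : Fin N → ℝ) : ℂ :=
  ∑ α ∈ A.support, ((A.coeff α : ℝ) : ℂ) * multiD α g x

/-- The power `Â^σ g = ∑_n A(n)^σ g_n e^{i n x}`, a sum in `L_2(𝕋^N)`; it converges exactly for
`g` in the domain of `Â^σ`. -/
def opPow {N : ℕ} (A : MvPolynomial (Fin N) ℝ) (σ : ℝ) (g : L2T N) : L2T N :=
  ∑' n : Fin N → ℤ, (((symbolAt A n ^ σ : ℝ) : ℂ) * coeff g n) • expL2 n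

/-- The Mittag-Leffler function `E_{ρ,μ}` on the real line. -/
def mittagLeffler (ρ μ z : ℝ) : ℝ := ∑' k : ℕ, z ^ k / Real.Gamma (ρ * k + μ)

/-- The Riemann–Liouville integral of order `β ≥ 0` (that is, `∂_t^{-β}`); order `0` is the
identity. -/
def fracInt (β : ℝ) (g : ℝ → ℂ) (t : ℝ) : ℂ :=
  if β = 0 then g t
  else ((Real.Gamma β : ℝ) : ℂ)⁻¹ * ∫ s in (0 : ℝ)..t, (((t - s) ^ (β - 1) : ℝ) : ℂ) * g s

/-- The Riemann–Liouville derivative `∂_t^ρ g = d/dt ∂_t^{ρ-1} g`, `0 < ρ ≤ 1`, of a function on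
`(0, T]`; at `t = T` the derivative is the left one. -/
def fracDeriv (ρ T : ℝ) (g : ℝ → ℂ) (t : ℝ) : ℂ :=
  derivWithin (fracInt (1 - ρ) g) (Set.Ioc 0 T) t

/-- `u` is a regular (classical) solution on `𝕋^N × (0, T]` of `∂_t^ρ u + A(D) u = f`,
`lim_{t → 0} ∂_t^{ρ-1} u = φ`, with `A(D)` of order `m`. -/
structure IsRegularSolution {N : ℕ} (A : MvPolynomial (Fin N) ℝ) (m : ℕ) (ρ T : ℝ)
    (φ : (Fin N → ℝ) → ℂ) (f u : (Fin N → ℝ) → ℝ → ℂ) : Prop where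
  periodic : ∀ t ∈ Set.Ioc 0 T, IsPeriodic fun x => u x t
  /-- the derivatives in `A(D) u` are classical, and `A(D) u ∈ C(𝕋^N × (0, T])` -/
  contDiff : ∀ t ∈ Set.Ioc 0 T, ContDiff ℝ m fun x => u x t
  continuous_diffOp : ContinuousOn
    (fun p : (Fin N → ℝ) × ℝ => diffOp A (fun y => u y p.2) p.1) (Set.univ ×ˢ Set.Ioc 0 T)
  /-- the integral `∂_t^{ρ-1} u` exists -/
  integrable : ρ < 1 → ∀ x, ∀ t ∈ Set.Ioc 0 T,
    IntervalIntegrable (fun s => (((t - s) ^ (1 - ρ - 1) : ℝ) : ℂ) * u x s) volume 0 t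
  /-- `∂_t^{ρ-1} u ∈ C(𝕋^N × [0, T])` -/
  continuous_fracInt : ∃ w : (Fin N → ℝ) × ℝ → ℂ,
    ContinuousOn w (Set.univ ×ˢ Set.Icc 0 T) ∧
      ∀ x, ∀ t ∈ Set.Ioc 0 T, w (x, t) = fracInt (1 - ρ) (u x) t
  /-- `∂_t^ρ u` exists and lies in `C(𝕋^N × (0, T])` -/
  differentiable : ∀ x, DifferentiableOn ℝ (fracInt (1 - ρ) (u x)) (Set.Ioc 0 T)
  continuous_fracDeriv : ContinuousOn
    (fun p : (Fin N → ℝ) × ℝ => fracDeriv ρ T (u p.1) p.2) (Set.univ ×ˢ Set.Ioc 0 T)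
  equation : ∀ x, ∀ t ∈ Set.Ioc 0 T,
    fracDeriv ρ T (u x) t + diffOp A (fun y => u y t) x = f x t
  initial : ∀ x, Tendsto (fracInt (1 - ρ) (u x)) (𝓝[>] 0) (𝓝 (φ x))

/-- The integrand `f_n(t - ξ) ξ^{ρ-1} E_{ρ,ρ}(-A(n) ξ^ρ)`. -/
def duhamelIntegrand {N : ℕ} (A : MvPolynomial (Fin N) ℝ) (ρ : ℝ) (f : ℝ → L2T N)
    (n : Fin N → ℤ) (t ξ : ℝ) : ℂ :=
  coeff (f (t - ξ)) n * ((ξ ^ (ρ - 1) * mittagLeffler ρ ρ (-symbolAt A n * ξ ^ ρ) : ℝ) : ℂ)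

/-- The coefficient
`φ_n t^{ρ-1} E_{ρ,ρ}(-A(n) t^ρ) + ∫_0^t f_n(t - ξ) ξ^{ρ-1} E_{ρ,ρ}(-A(n) ξ^ρ) dξ`. -/
def solCoeff {N : ℕ} (A : MvPolynomial (Fin N) ℝ) (ρ : ℝ) (φ : L2T N) (f : ℝ → L2T N)
    (n : Fin N → ℤ) (t : ℝ) : ℂ :=
  coeff φ n * ((t ^ (ρ - 1) * mittagLeffler ρ ρ (-symbolAt A n * t ^ ρ) : ℝ) : ℂ)
    + ∫ ξ in (0 : ℝ)..t, duhamelIntegrand A ρ f n t ξ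

end

end TorusSubdiffusion

open TorusSubdiffusion

namespace TorusSubdiffusion

open MeasureTheory Set Filter Topology

noncomputable section

/-! Expansion in exponentials decouples the problem into scalar equations `∂_t^ρ y + Λ y = f_n` with
`Λ = A(n) ≥ 0`. Write `e_Λ` for `mlKernel` and `r_Λ` for `mlRelax`. The scalar solution is `mode`,
that is `φ_n e_Λ + e_Λ * f_n`. Its Riemann–Liouville integral of order `1 - ρ` is `modeInt`, the
same expression with `r_Λ` in place of `e_Λ`, and `r_Λ' = -Λ e_Λ` yields the equation. The
identities between these kernels come from convolving power series in `t ^ ρ` termwise with powers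
of `t`.

Summation over `n` needs bounds uniform in `Λ ≥ 0`: `0 ≤ r_Λ ≤ 1`, `e_Λ(t) ≤ t ^ (ρ - 1) / Γ(ρ)` and
`Λ t e_Λ(t) ≤ 1`. Each drops a nonnegative term from a convolution identity, so all of them rest on
the positivity of `e_Λ`. For `ρ < 1` this is `mlKernel_pos_of_lt_one`, proved by looking at a first
zero.

On the data side, `τ > N/2` and Cauchy–Schwarz bound the tails of `∑ |f_n(t)|` uniformly in `t` by
the norm of `F(t)` (`unifSummableOn_coeff`). The suprema over `t` of the single terms need not be
summable, so `UnifSummableOn` takes the place of the Weierstrass test.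

The critical series is `A(D) u`. For the initial datum, `Λ t e_Λ(t) ≤ 1` suffices away from `t = 0`.
In the Duhamel term the same bound gives only `1 / ξ`, which is not integrable. The strict
inequality `τ > N/2` leaves room for a factor `A(n) ^ ε` on `f_n`, and interpolation between the two
bounds on `e_Λ` gives `Λ ^ (1 - ε) e_Λ(ξ) ≤ C ξ ^ (ε ρ - 1)`, which is integrable
(`unifSummableOn_mul_mode`). Ellipticity then turns absolute convergence of `∑ A(n) u_n` into `C^m`
regularity in `x`. The fractional integral passes through the sum by `L¹` bounds, and the time
derivative by locally uniform convergence of the differentiated series. -/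

theorem integrable_and_hasSum_integral {α E ι : Type*} [MeasurableSpace α] {μ : Measure α}
    [NormedAddCommGroup E] [NormedSpace ℝ E] [CompleteSpace E] [Countable ι]
    {F : ι → α → E} (hF : ∀ i, Integrable (F i) μ) (hs : Summable fun i => ∫ a, ‖F i a‖ ∂μ)
    {g : α → E} (hg : ∀ᵐ a ∂μ, HasSum (fun i => F i a) (g a)) :
    Integrable g μ ∧ HasSum (fun i => ∫ a, F i a ∂μ) (∫ a, g a ∂μ) := by
  have hfin : ∑' i, ∫⁻ a, ‖F i a‖ₑ ∂μ ≠ ⊤ := by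
    have (i : ι) : ∫⁻ a, ‖F i a‖ₑ ∂μ = ‖∫ a, ‖F i a‖ ∂μ‖ₑ := by
      rw [← ofReal_integral_norm_eq_lintegral_enorm (hF i), Real.enorm_eq_ofReal]
      exact integral_nonneg fun a => norm_nonneg _
    simp_rw [this]
    exact tsum_enorm_ne_top_iff_summable_norm.2 (by simpa using hs.abs)
  refine ⟨⟨?_, ?_⟩, ?_⟩
  · exact aestronglyMeasurable_of_tendsto_ae atTop (f := fun (s : Finset ι) a => ∑ i ∈ s, F i a)
      (fun s => by
        simpa using Finset.aestronglyMeasurable_fun_sum s fun i _ => (hF i).aestronglyMeasurable) hg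
  · refine lt_of_le_of_lt (lintegral_mono_ae (g := fun a => ∑' i, ‖F i a‖ₑ) ?_) ?_
    · filter_upwards [hg] with a ha
      rw [← ha.tsum_eq]
      exact enorm_tsum_le_tsum_enorm
    · rw [lintegral_tsum fun i => (hF i).aestronglyMeasurable.enorm]
      exact hfin.lt_top
  · have h := hasSum_integral_of_summable_integral_norm hF hs
    rwa [integral_congr_ae (hg.mono fun a ha => ha.tsum_eq)] at h

/-! ### Riemann–Liouville kernels -/

/-- The Riemann–Liouville kernel `t ^ (a - 1) / Γ(a)`. -/
def rlKernel (a t : ℝ) : ℝ := t ^ (a - 1) / Real.Gamma a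

theorem rlKernel_nonneg {a t : ℝ} (ha : 0 < a) (ht : 0 ≤ t) : 0 ≤ rlKernel a t :=
  div_nonneg (Real.rpow_nonneg ht _) (Real.Gamma_pos_of_pos ha).le

theorem rlKernel_pos {a t : ℝ} (ha : 0 < a) (ht : 0 < t) : 0 < rlKernel a t :=
  div_pos (Real.rpow_pos_of_pos ht _) (Real.Gamma_pos_of_pos ha)

/-- Euler's Beta integral: with the factor `1 / Γ(a)`, the kernels form a semigroup under
convolution. -/
theorem integral_rlKernel_mul_rlKernel {a b t : ℝ} (ha : 0 < a) (hb : 0 < b) (ht : 0 < t) :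
    ∫ s in (0 : ℝ)..t, rlKernel b (t - s) * rlKernel a s = rlKernel (a + b) t := by
  have h := Complex.betaIntegral_scaled (a : ℂ) (b : ℂ) ht
  rw [Complex.betaIntegral_eq_Gamma_mul_div _ _ (by simpa using ha) (by simpa using hb)] at h
  have h2 : ∫ x in (0 : ℝ)..t, (x : ℂ) ^ ((a : ℂ) - 1) * ((t : ℂ) - x) ^ ((b : ℂ) - 1)
      = ((∫ x in (0 : ℝ)..t, x ^ (a - 1) * (t - x) ^ (b - 1) : ℝ) : ℂ) := by
    rw [← intervalIntegral.integral_ofReal]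
    refine intervalIntegral.integral_congr fun x hx => ?_
    rw [uIcc_of_le ht.le] at hx
    rw [Complex.ofReal_mul, Complex.ofReal_cpow hx.1, Complex.ofReal_cpow (sub_nonneg.2 hx.2)]
    push_cast
    rfl
  have h3 : ∫ x in (0 : ℝ)..t, x ^ (a - 1) * (t - x) ^ (b - 1)
      = t ^ (a + b - 1) * (Real.Gamma a * Real.Gamma b / Real.Gamma (a + b)) := by
    have h4 : ((t ^ (a + b - 1) : ℝ) : ℂ) = (t : ℂ) ^ ((a : ℂ) + b - 1) := by
      rw [Complex.ofReal_cpow ht.le]; push_cast; rfl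
    rw [h2, ← h4, ← Complex.ofReal_add, Complex.Gamma_ofReal, Complex.Gamma_ofReal,
      Complex.Gamma_ofReal] at h
    exact_mod_cast h
  have hga := (Real.Gamma_pos_of_pos ha).ne'
  have hgb := (Real.Gamma_pos_of_pos hb).ne'
  calc ∫ s in (0 : ℝ)..t, rlKernel b (t - s) * rlKernel a s
      = ∫ s in (0 : ℝ)..t, (Real.Gamma a * Real.Gamma b)⁻¹ * (s ^ (a - 1) * (t - s) ^ (b - 1)) := by
        refine intervalIntegral.integral_congr fun x _ => ?_
        simp only [rlKernel]
        field_simp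
    _ = rlKernel (a + b) t := by
        rw [intervalIntegral.integral_const_mul, h3, rlKernel]
        field_simp

theorem intervalIntegrable_rlKernel_mul_rlKernel {a b t : ℝ} (ha : 0 < a) (hb : 0 < b)
    (ht : 0 < t) :
    IntervalIntegrable (fun s => rlKernel b (t - s) * rlKernel a s) volume 0 t := by
  -- A non-integrable function has integral `0` by convention, so the nonzero value already computed
  -- proves integrability.
  refine intervalIntegral.intervalIntegrable_of_integral_ne_zero ?_
  rw [integral_rlKernel_mul_rlKernel ha hb ht]
  exact (rlKernel_pos (add_pos ha hb) ht).ne'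

/-- The semigroup law is applied termwise; all kernels are nonnegative, so the `L¹` norms of the
terms are exactly the series assumed summable. -/
theorem integral_rlKernel_mul_series {a c : ℕ → ℝ} {b t : ℝ} (ha : ∀ k, 0 < a k) (hb : 0 < b)
    (ht : 0 < t) (hs : Summable fun k => |c k| * rlKernel (a k + b) t) {g : ℝ → ℝ}
    (hg : ∀ s ∈ Ioc 0 t, HasSum (fun k => c k * rlKernel (a k) s) (g s)) :
    IntervalIntegrable (fun s => rlKernel b (t - s) * g s) volume 0 t ∧
      HasSum (fun k => c k * rlKernel (a k + b) t)
        (∫ s in (0 : ℝ)..t, rlKernel b (t - s) * g s) := by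
  have key := integrable_and_hasSum_integral (μ := volume.restrict (Ioc 0 t))
    (F := fun k s => c k * (rlKernel b (t - s) * rlKernel (a k) s))
    (g := fun s => rlKernel b (t - s) * g s)
    (fun k => ((intervalIntegrable_iff_integrableOn_Ioc_of_le ht.le).1
      (intervalIntegrable_rlKernel_mul_rlKernel (ha k) hb ht)).const_mul (c k)) ?_ ?_
  · rw [intervalIntegrable_iff_integrableOn_Ioc_of_le ht.le, intervalIntegral.integral_of_le ht.le]
    refine ⟨key.1, ?_⟩
    refine key.2.congr_fun fun k => ?_
    rw [integral_const_mul, ← intervalIntegral.integral_of_le ht.le,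
      integral_rlKernel_mul_rlKernel (ha k) hb ht]
  · convert hs using 2 with k
    rw [← integral_rlKernel_mul_rlKernel (ha k) hb ht, intervalIntegral.integral_of_le ht.le,
      ← integral_const_mul]
    refine setIntegral_congr_fun measurableSet_Ioc fun s hs => ?_
    simp only [norm_mul, Real.norm_eq_abs]
    rw [abs_of_nonneg (rlKernel_nonneg hb (sub_nonneg.2 hs.2)),
      abs_of_nonneg (rlKernel_nonneg (ha k) hs.1.le)]
  · refine (ae_restrict_iff' measurableSet_Ioc).2 (Eventually.of_forall fun s hs => ?_)
    exact ((hg s hs).mul_left (rlKernel b (t - s))).congr_fun fun k => by ring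

/-! ### Convergence and smoothness of the Mittag-Leffler series -/

/-- Keeping only the part of Euler's integral over `(B, B + 1]` shows that `Γ` outgrows every
geometric sequence, which is all that the convergence of the series needs. -/
theorem rpow_mul_exp_le_Gamma {B x : ℝ} (hB : 0 < B) (hx : 1 ≤ x) :
    B ^ (x - 1) * Real.exp (-(B + 1)) ≤ Real.Gamma x := by
  have hint := Real.GammaIntegral_convergent (by linarith : 0 < x)
  have hsub : Ioc B (B + 1) ⊆ Ioi (0 : ℝ) := fun y hy => hB.trans hy.1
  rw [Real.Gamma_eq_integral (by linarith)]
  refine le_trans ?_ (setIntegral_mono_set hint ?_ hsub.eventuallyLE)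
  · have := setIntegral_ge_of_const_le_real (μ := volume) (c := B ^ (x - 1) * Real.exp (-(B + 1)))
      measurableSet_Ioc (by simp) (fun y (hy : y ∈ Ioc B (B + 1)) => ?_) (hint.mono_set hsub)
    · simpa using this
    · rw [mul_comm]
      gcongr
      · exact hy.2
      · exact hy.1.le
  · exact (ae_restrict_iff' measurableSet_Ioi).2 (Eventually.of_forall fun y (hy : 0 < y) => by
      simp only [Pi.zero_apply]; positivity)

theorem summable_mittagLeffler {ρ : ℝ} (hρ : 0 < ρ) (μ R : ℝ) :
    Summable fun k : ℕ => R ^ k / Real.Gamma (ρ * k + μ) := by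
  -- `B` is chosen with `B ^ ρ = Q > |R|`, so the Gamma bound produces a geometric majorant of ratio
  -- `|R| / Q < 1`.
  set Q := 2 * |R| + 1 with hQ
  have hQ0 : 0 < Q := by positivity
  set B := Q ^ (1 / ρ) with hB
  have hB0 : 0 < B := Real.rpow_pos_of_pos hQ0 _
  have hBρ : B ^ ρ = Q := by
    rw [hB, ← Real.rpow_mul hQ0.le, one_div_mul_cancel hρ.ne', Real.rpow_one]
  have hlt : |R| / Q < 1 := by
    rw [div_lt_one hQ0]; linarith [abs_nonneg R]
  refine Summable.of_norm_bounded_eventually_nat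
    (g := fun k : ℕ => Real.exp (B + 1) * B ^ (1 - μ) * (|R| / Q) ^ k)
    ((summable_geometric_of_lt_one (by positivity) hlt).mul_left _) ?_
  have hk : ∀ᶠ k : ℕ in atTop, 1 ≤ ρ * k + μ := by
    have : Tendsto (fun k : ℕ => ρ * (k : ℝ) + μ) atTop atTop :=
      tendsto_atTop_add_const_right _ _ (tendsto_natCast_atTop_atTop.const_mul_atTop hρ)
    exact this.eventually_ge_atTop 1
  filter_upwards [hk] with k hk
  have hG := rpow_mul_exp_le_Gamma hB0 hk
  have hpos : 0 < B ^ (ρ * k + μ - 1) * Real.exp (-(B + 1)) := by positivity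
  rw [norm_div, norm_pow, Real.norm_eq_abs, Real.norm_eq_abs,
    abs_of_pos (hpos.trans_le hG)]
  refine (div_le_div_of_nonneg_left (by positivity) hpos hG).trans (le_of_eq ?_)
  have h1 : B ^ (ρ * k + μ - 1) = Q ^ k / B ^ (1 - μ) := by
    rw [show ρ * k + μ - 1 = ρ * k - (1 - μ) by ring, Real.rpow_sub hB0, Real.rpow_mul hB0.le,
      hBρ, Real.rpow_natCast]
  have hE : Real.exp (-(B + 1)) * Real.exp (B + 1) = 1 := by
    rw [← Real.exp_add]; simp
  have := (Real.exp_pos (-(B+1))).ne'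
  have := (Real.rpow_pos_of_pos hB0 (1 - μ)).ne'
  rw [h1, div_pow]
  field_simp
  rw [mul_assoc, hE, mul_one]

/-- The series converges uniformly on complex discs, hence is holomorphic there; the real function
is its restriction to the real axis. -/
theorem differentiable_mittagLeffler {ρ : ℝ} (hρ : 0 < ρ) (μ : ℝ) :
    Differentiable ℝ (mittagLeffler ρ μ) := by
  intro x
  set G : ℂ → ℂ := fun z => ∑' k : ℕ, z ^ k / (Real.Gamma (ρ * k + μ) : ℂ) with hG
  have hd : DifferentiableOn ℂ G (Metric.ball 0 (|x| + 1)) := by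
    refine Complex.differentiableOn_tsum_of_summable_norm
      (u := fun k : ℕ => |(|x| + 1) ^ k / Real.Gamma (ρ * k + μ)|)
      (summable_mittagLeffler hρ μ (|x| + 1)).abs (fun k => by fun_prop) Metric.isOpen_ball
      fun k w hw => ?_
    have hw' : ‖w‖ ≤ |x| + 1 := (mem_ball_zero_iff.1 hw).le
    rw [norm_div, norm_pow, Complex.norm_real, Real.norm_eq_abs, abs_div, abs_pow,
      abs_of_nonneg (by positivity : 0 ≤ |x| + 1)]
    gcongr
  have hx : DifferentiableAt ℂ G (x : ℂ) :=
    hd.differentiableAt (Metric.isOpen_ball.mem_nhds (by simp))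
  have hr := hx.hasDerivAt.real_of_complex
  have he : (fun y : ℝ => (G y).re) = mittagLeffler ρ μ := by
    ext y
    have : G y = ((mittagLeffler ρ μ y : ℝ) : ℂ) := by
      simp only [hG, mittagLeffler]
      push_cast
      rfl
    rw [this, Complex.ofReal_re]
  rw [he] at hr
  exact hr.differentiableAt

/-! ### Convolution identities for the resolvent kernel and the relaxation function -/

/-- The kernel `t ^ (ρ - 1) E_{ρ,ρ}(-Λ t ^ ρ)` of the resolvent of the fractional relaxation
equation. -/
def mlKernel (ρ Λ t : ℝ) : ℝ := t ^ (ρ - 1) * mittagLeffler ρ ρ (-Λ * t ^ ρ)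

/-- The relaxation function `E_{ρ,1}(-Λ t ^ ρ)`. -/
def mlRelax (ρ Λ t : ℝ) : ℝ := mittagLeffler ρ 1 (-Λ * t ^ ρ)

section Series

variable {ρ : ℝ} (hρ : 0 < ρ) (Λ : ℝ) {t : ℝ} (ht : 0 < t)

include ht in
theorem pow_mul_rlKernel (b : ℝ) (k : ℕ) :
    Λ ^ k * rlKernel (ρ * k + b) t
      = t ^ (b - 1) * ((Λ * t ^ ρ) ^ k / Real.Gamma (ρ * k + b)) := by
  rw [rlKernel, show ρ * k + b - 1 = ρ * k + (b - 1) by ring, Real.rpow_add ht, Real.rpow_mul ht.le,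
    Real.rpow_natCast, mul_pow]
  ring

include hρ ht

theorem hasSum_rlKernel (b : ℝ) :
    HasSum (fun k : ℕ => (-Λ) ^ k * rlKernel (ρ * k + b) t)
      (t ^ (b - 1) * mittagLeffler ρ b (-Λ * t ^ ρ)) :=
  ((summable_mittagLeffler hρ b (-Λ * t ^ ρ)).hasSum.mul_left _).congr_fun
    fun k => pow_mul_rlKernel (-Λ) ht b k

theorem hasSum_mlKernel :
    HasSum (fun k : ℕ => (-Λ) ^ k * rlKernel (ρ * k + ρ) t) (mlKernel ρ Λ t) :=
  hasSum_rlKernel hρ Λ ht ρ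

theorem hasSum_mlRelax :
    HasSum (fun k : ℕ => (-Λ) ^ k * rlKernel (ρ * k + 1) t) (mlRelax ρ Λ t) := by
  simpa [mlRelax] using hasSum_rlKernel hρ Λ ht 1

theorem summable_abs_mul_rlKernel {b : ℝ} (hb : 0 < b) :
    Summable fun k : ℕ => |(-Λ) ^ k * (k + 1)| * rlKernel (ρ * k + b) t := by
  refine Summable.of_nonneg_of_le
    (fun k => mul_nonneg (abs_nonneg _) (rlKernel_nonneg (by positivity) ht.le)) (fun k => ?_)
    ((summable_mittagLeffler hρ b (2 * |Λ| * t ^ ρ)).mul_left (t ^ (b - 1)))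
  rw [← pow_mul_rlKernel _ ht]
  refine mul_le_mul_of_nonneg_right ?_ (rlKernel_nonneg (by positivity) ht.le)
  rw [abs_mul, abs_pow, abs_neg, mul_pow, mul_comm, abs_of_nonneg (by positivity)]
  refine mul_le_mul_of_nonneg_right ?_ (by positivity)
  -- The factor `k + 1` is absorbed by `2 ^ k`, whence the comparison series at `2 |Λ| t ^ ρ`.
  exact_mod_cast Nat.lt_two_pow_self

theorem summable_abs_rlKernel {b : ℝ} (hb : 0 < b) :
    Summable fun k : ℕ => |(-Λ) ^ k| * rlKernel (ρ * k + b) t := by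
  refine Summable.of_nonneg_of_le
    (fun k => mul_nonneg (abs_nonneg _) (rlKernel_nonneg (by positivity) ht.le)) (fun k => ?_)
    (summable_abs_mul_rlKernel hρ Λ ht hb)
  refine mul_le_mul_of_nonneg_right ?_ (rlKernel_nonneg (by positivity) ht.le)
  rw [abs_mul]
  refine le_mul_of_one_le_right (abs_nonneg _) ?_
  rw [abs_of_nonneg (by positivity)]
  simp

theorem integral_rlKernel_mul_mlKernel {b : ℝ} (hb : 0 < b) :
    IntervalIntegrable (fun s => rlKernel b (t - s) * mlKernel ρ Λ s) volume 0 t ∧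
      HasSum (fun k : ℕ => (-Λ) ^ k * rlKernel (ρ * k + ρ + b) t)
        (∫ s in (0 : ℝ)..t, rlKernel b (t - s) * mlKernel ρ Λ s) := by
  refine integral_rlKernel_mul_series (a := fun k : ℕ => ρ * k + ρ) (c := fun k => (-Λ) ^ k)
    (fun k => by positivity) hb ht ?_ fun s hs => hasSum_mlKernel hρ Λ hs.1
  simpa only [add_assoc] using summable_abs_rlKernel hρ Λ ht (add_pos hρ hb)

/-- Convolution with the kernel of order `1 - ρ` raises each exponent index from `ρ k + ρ` to `ρ k +
1`. Thus `r_Λ` is the fractional integral of `e_Λ`. -/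
theorem integral_rlKernel_mul_mlKernel_eq_mlRelax (hρ₁ : ρ < 1) :
    ∫ s in (0 : ℝ)..t, rlKernel (1 - ρ) (t - s) * mlKernel ρ Λ s = mlRelax ρ Λ t := by
  refine (integral_rlKernel_mul_mlKernel hρ Λ ht (sub_pos.2 hρ₁)).2.unique ?_
  refine (hasSum_mlRelax hρ Λ ht).congr_fun fun k => ?_
  rw [show ρ * k + ρ + (1 - ρ) = ρ * k + 1 by ring]

theorem intervalIntegrable_mlKernel : IntervalIntegrable (mlKernel ρ Λ) volume 0 t := by
  simpa [rlKernel] using (integral_rlKernel_mul_mlKernel hρ Λ ht one_pos).1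

theorem hasSum_integral_mlKernel :
    HasSum (fun k : ℕ => (-Λ) ^ k * rlKernel (ρ * k + ρ + 1) t)
      (∫ s in (0 : ℝ)..t, mlKernel ρ Λ s) := by
  simpa [rlKernel] using (integral_rlKernel_mul_mlKernel hρ Λ ht one_pos).2

/-- The `k = 0` term of the relaxation series is `1`; after an index shift the others are `-Λ` times
the integrated kernel series. -/
theorem mlRelax_eq_one_sub_integral :
    mlRelax ρ Λ t = 1 - Λ * ∫ s in (0 : ℝ)..t, mlKernel ρ Λ s := by
  have h := (hasSum_nat_add_iff (f := fun k : ℕ => (-Λ) ^ k * rlKernel (ρ * k + 1) t) 1).1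
    (((hasSum_integral_mlKernel hρ Λ ht).mul_left (-Λ)).congr_fun fun k => ?_)
  · have h1 : rlKernel 1 t = 1 := by simp [rlKernel]
    have h2 := (hasSum_mlRelax hρ Λ ht).unique h
    rw [h2, Finset.sum_range_one]
    simp only [pow_zero, Nat.cast_zero, mul_zero, zero_add, h1]
    ring
  · push_cast
    rw [show ρ * ((k : ℝ) + 1) + 1 = ρ * k + ρ + 1 by ring]
    ring

/-- The Volterra resolvent equation, again an index shift. Once `e_Λ` is known to be positive, it
gives the bound `mlKernel_le_rlKernel`. -/
theorem mlKernel_add_integral :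
    mlKernel ρ Λ t + Λ * ∫ s in (0 : ℝ)..t, rlKernel ρ (t - s) * mlKernel ρ Λ s
      = rlKernel ρ t := by
  have h := (hasSum_nat_add_iff (f := fun k : ℕ => (-Λ) ^ k * rlKernel (ρ * k + ρ) t) 1).1
    (((integral_rlKernel_mul_mlKernel hρ Λ ht hρ).2.mul_left (-Λ)).congr_fun fun k => ?_)
  · have := h.unique (hasSum_mlKernel hρ Λ ht)
    rw [← this]
    simp
  · push_cast
    rw [show ρ * ((k : ℝ) + 1) + ρ = ρ * k + ρ + ρ by ring]
    ring

/-- Multiplication by `t` sends the kernel of order `a` to `a` times the kernel of order `a + 1`;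
here `a = ρ (k + 1)`. -/
theorem hasSum_mul_mlKernel :
    HasSum (fun k : ℕ => (-Λ) ^ k * (k + 1) * rlKernel (ρ * k + (ρ + 1)) t)
      (ρ⁻¹ * (t * mlKernel ρ Λ t)) := by
  rw [← mul_assoc]
  refine ((hasSum_mlKernel hρ Λ ht).mul_left (ρ⁻¹ * t)).congr_fun fun k => ?_
  have hk : 0 < ρ * k + ρ := by positivity
  have hG := (Real.Gamma_pos_of_pos hk).ne'
  rw [rlKernel, rlKernel, show ρ * k + (ρ + 1) = ρ * k + ρ + 1 by ring, Real.Gamma_add_one hk.ne',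
    add_sub_cancel_right, Real.rpow_sub_one ht.ne']
  field_simp

/-- On the Laplace side `e_Λ` is `1 / (p ^ ρ + Λ)`, so `t e_Λ` is `ρ p ^ (ρ - 1) / (p ^ ρ + Λ) ^ 2`,
and the factor `1 + Λ p ^ (-ρ)` cancels one denominator. The proof makes this cancellation on power
series. The identity serves to bound `Λ t e_Λ(t)`. -/
theorem mul_mlKernel_add_integral :
    t * mlKernel ρ Λ t + Λ * ∫ s in (0 : ℝ)..t, rlKernel ρ (t - s) * (s * mlKernel ρ Λ s)
      = ρ * ∫ s in (0 : ℝ)..t, mlKernel ρ Λ s := by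
  have h := (integral_rlKernel_mul_series (a := fun k : ℕ => ρ * k + (ρ + 1))
    (c := fun k => (-Λ) ^ k * (k + 1)) (g := fun s => ρ⁻¹ * (s * mlKernel ρ Λ s))
    (fun k => by positivity) hρ ht
    (by simpa only [add_assoc] using
      summable_abs_mul_rlKernel hρ Λ ht (by positivity : 0 < ρ + (1 + ρ)))
    fun s hs => hasSum_mul_mlKernel hρ Λ hs.1).2
  have h2 := (hasSum_nat_add_iff
    (f := fun k : ℕ => (-Λ) ^ k * k * rlKernel (ρ * k + (ρ + 1)) t) 1).1
    ((h.mul_left (-Λ)).congr_fun fun k => by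
      push_cast
      rw [show ρ * ((k : ℝ) + 1) + (ρ + 1) = ρ * k + (ρ + 1) + ρ by ring]
      ring)
  have h3 := ((hasSum_mul_mlKernel hρ Λ ht).sub h2).unique
    ((hasSum_integral_mlKernel hρ Λ ht).congr_fun fun k => by rw [← add_assoc]; ring)
  have h4 : ∫ s in (0 : ℝ)..t, rlKernel ρ (t - s) * (ρ⁻¹ * (s * mlKernel ρ Λ s))
      = ρ⁻¹ * ∫ s in (0 : ℝ)..t, rlKernel ρ (t - s) * (s * mlKernel ρ Λ s) := by
    rw [← intervalIntegral.integral_const_mul]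
    congr 1 with s
    ring
  rw [h4] at h3
  rw [← h3]
  field_simp
  simp

end Series

theorem differentiableOn_mlKernel {ρ : ℝ} (hρ : 0 < ρ) (Λ : ℝ) :
    DifferentiableOn ℝ (mlKernel ρ Λ) (Ioi 0) := by
  intro t ht
  have h1 : DifferentiableAt ℝ (fun t : ℝ => t ^ ρ) t :=
    Real.differentiableAt_rpow_const_of_ne _ (ne_of_gt ht)
  have h2 : DifferentiableAt ℝ (fun t : ℝ => t ^ (ρ - 1)) t :=
    Real.differentiableAt_rpow_const_of_ne _ (ne_of_gt ht)
  have h3 : DifferentiableAt ℝ (fun t : ℝ => mittagLeffler ρ ρ (-Λ * t ^ ρ)) t :=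
    (differentiable_mittagLeffler hρ ρ _).comp t (h1.const_mul (-Λ))
  exact (h2.mul h3).differentiableWithinAt

theorem hasDerivAt_mlRelax {ρ : ℝ} (hρ : 0 < ρ) (Λ : ℝ) {t : ℝ} (ht : 0 < t) :
    HasDerivAt (mlRelax ρ Λ) (-Λ * mlKernel ρ Λ t) t := by
  have hd := differentiableOn_mlKernel hρ Λ
  have h1 : HasDerivAt (fun t => ∫ s in (0 : ℝ)..t, mlKernel ρ Λ s) (mlKernel ρ Λ t) t :=
    intervalIntegral.integral_hasDerivAt_right (intervalIntegrable_mlKernel hρ Λ ht)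
      (hd.continuousOn.stronglyMeasurableAtFilter isOpen_Ioi t ht)
      (hd.differentiableAt (Ioi_mem_nhds ht)).continuousAt
  have h2 : HasDerivAt (fun t => 1 - Λ * ∫ s in (0 : ℝ)..t, mlKernel ρ Λ s)
      (-Λ * mlKernel ρ Λ t) t := by
    exact ((h1.const_mul Λ).const_sub 1).congr_deriv (by ring)
  refine h2.congr_of_eventuallyEq ?_
  filter_upwards [Ioi_mem_nhds ht] with s hs
  exact mlRelax_eq_one_sub_integral hρ Λ hs

/-! ### Positivity of the resolvent kernel -/

/-- The convex function `x ^ (-ρ)` lies above its tangent at `x + h`; this quantifies the decay of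
the kernel of order `1 - ρ`. -/
theorem mul_le_rpow_neg_sub_rpow_neg {ρ x h : ℝ} (hρ : 0 < ρ) (hx : 0 < x) (hh : 0 ≤ h) :
    ρ * h * (x + h) ^ (-ρ - 1) ≤ x ^ (-ρ) - (x + h) ^ (-ρ) := by
  have hxh : 0 < x + h := by positivity
  have h1 : 1 + ρ * (h / (x + h)) ≤ (x / (x + h)) ^ (-ρ) := by
    rw [Real.rpow_def_of_pos (by positivity)]
    have h2 := Real.log_le_sub_one_of_pos (by positivity : 0 < x / (x + h))
    have h3 := Real.add_one_le_exp (Real.log (x / (x + h)) * -ρ)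
    have h4 : x / (x + h) - 1 = -(h / (x + h)) := by field_simp; ring
    rw [h4] at h2
    nlinarith
  have h5 : x ^ (-ρ) = (x / (x + h)) ^ (-ρ) * (x + h) ^ (-ρ) := by
    rw [← Real.mul_rpow (by positivity) hxh.le, div_mul_cancel₀ _ hxh.ne']
  have h6 := mul_le_mul_of_nonneg_right h1 (Real.rpow_nonneg hxh.le (-ρ))
  rw [← h5] at h6
  rw [Real.rpow_sub_one hxh.ne']
  have : ρ * h * ((x + h) ^ (-ρ) / (x + h)) = ρ * (h / (x + h)) * (x + h) ^ (-ρ) := by ring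
  linarith

theorem exists_first_zero {g : ℝ → ℝ} (hg : ContinuousOn g (Ici 0)) (h0 : 0 < g 0) {t : ℝ}
    (ht : 0 ≤ t) (hgt : g t ≤ 0) : ∃ t₀, 0 < t₀ ∧ g t₀ = 0 ∧ ∀ s ∈ Ico 0 t₀, 0 < g s := by
  set S := {s | s ∈ Ici (0 : ℝ) ∧ g s ≤ 0} with hS
  have hcl : IsClosed S := hg.preimage_isClosed_of_isClosed isClosed_Ici isClosed_Iic
  have hbdd : BddBelow S := ⟨0, fun s hs => hs.1⟩
  have hmem : sInf S ∈ S := hcl.csInf_mem ⟨t, ht, hgt⟩ hbdd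
  have hlt : ∀ s ∈ Ico 0 (sInf S), 0 < g s := fun s hs => by
    by_contra! h
    exact (csInf_le hbdd ⟨hs.1, h⟩).not_gt hs.2
  have hne : sInf S ≠ 0 := fun h => by
    rw [h] at hmem
    exact hmem.2.not_gt h0
  have hpos : 0 < sInf S := lt_of_le_of_ne hmem.1 hne.symm
  refine ⟨sInf S, hpos, le_antisymm hmem.2 ?_, hlt⟩
  have hc : Tendsto g (𝓝[Ico 0 (sInf S)] (sInf S)) (𝓝 (g (sInf S))) :=
    (hg _ hmem.1).mono Ico_subset_Ici_self
  have : (𝓝[Ico 0 (sInf S)] (sInf S)).NeBot :=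
    mem_closure_iff_nhdsWithin_neBot.1 (by rw [closure_Ico hpos.ne]; exact ⟨hpos.le, le_rfl⟩)
  exact ge_of_tendsto hc (eventually_mem_nhdsWithin.mono fun s hs => (hlt s hs).le)

/-- At a first zero `t₀` of `e_Λ` the derivative `-Λ e_Λ(t₀)` of `r_Λ` vanishes. But `r_Λ` is the
convolution of a strictly decreasing kernel with `e_Λ`, which is positive before `t₀`. Passing from
`t₀` to `t₀ + h` loses an amount of order `h` from the past, while the new interval contributes only
`O(h ^ (2 - ρ))`. So the right derivative is negative, a contradiction. The sign of `Λ` plays no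
role. -/
theorem mlKernel_pos_of_lt_one {ρ Λ t : ℝ} (hρ : 0 < ρ) (hρ₁ : ρ < 1) (ht : 0 < t) :
    0 < mlKernel ρ Λ t := by
  set g : ℝ → ℝ := fun t => mittagLeffler ρ ρ (-Λ * t ^ ρ) with hg
  have hgc : Continuous g := (differentiable_mittagLeffler hρ ρ).continuous.comp
    (continuous_const.mul (Real.continuous_rpow_const hρ.le))
  have hg0 : 0 < g 0 := by
    have : g 0 = (Real.Gamma ρ)⁻¹ := by
      simp only [hg, mittagLeffler, Real.zero_rpow hρ.ne', mul_zero]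
      rw [tsum_eq_single 0 (fun k hk => by simp [hk])]
      simp
    rw [this]
    exact inv_pos.2 (Real.Gamma_pos_of_pos hρ)
  by_contra! hneg
  obtain ⟨t₀, ht₀, hgt₀, hpos⟩ := exists_first_zero hgc.continuousOn hg0 ht.le
    (nonpos_of_mul_nonpos_right hneg (Real.rpow_pos_of_pos ht _))
  set e := mlKernel ρ Λ with he
  have het₀ : e t₀ = 0 := by simp only [he, mlKernel]; rw [show mittagLeffler ρ ρ _ = g t₀ from rfl,
    hgt₀, mul_zero]
  have hepos : ∀ s ∈ Ioo 0 t₀, 0 < e s := fun s hs =>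
    mul_pos (Real.rpow_pos_of_pos hs.1 _) (hpos s ⟨hs.1.le, hs.2⟩)
  have hder := hasDerivAt_mlRelax hρ Λ ht₀
  rw [← he, het₀, mul_zero, hasDerivAt_iff_tendsto_slope_zero] at hder
  have hder' := hder.mono_left (nhdsWithin_mono 0 (fun x (hx : 0 < x) => hx.ne') :
    𝓝[>] (0 : ℝ) ≤ 𝓝[≠] 0)
  -- Since `e` vanishes at `t₀`, differentiability gives `|e s| ≤ L |s - t₀|` nearby.
  obtain ⟨L, hL⟩ := ((differentiableOn_mlKernel hρ Λ).differentiableAt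
    (Ioi_mem_nhds ht₀)).isBigO_sub.bound
  obtain ⟨δ, hδ, hLδ⟩ := Metric.eventually_nhds_iff.1 hL
  have hΓ : 0 < Real.Gamma (1 - ρ) := Real.Gamma_pos_of_pos (sub_pos.2 hρ₁)
  set J := ∫ s in (0 : ℝ)..t₀, e s with hJ
  have hJpos : 0 < J := intervalIntegral.intervalIntegral_pos_of_pos_on
    (intervalIntegrable_mlKernel hρ Λ ht₀) hepos ht₀
  -- A decay rate for the kernel valid for all `s` in `(0, t₀)` and `h < 1`, because then `t₀ - s +
  -- h ≤ t₀ + 1`.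
  set c := ρ * (t₀ + 1) ^ (-ρ - 1) / Real.Gamma (1 - ρ) with hc
  have hcpos : 0 < c := by positivity
  have hkey : ∀ᶠ h in 𝓝[>] (0 : ℝ), h⁻¹ • (mlRelax ρ Λ (t₀ + h) - mlRelax ρ Λ t₀)
      ≤ -(c * J) + |L| / Real.Gamma (1 - ρ) / (1 - ρ) * h ^ (1 - ρ) := by
    filter_upwards [Ioo_mem_nhdsGT (lt_min hδ one_pos)] with h hh
    have hh0 : 0 < h := hh.1
    have hhδ : h < δ := hh.2.trans_le (min_le_left _ _)
    have hh1 : h < 1 := hh.2.trans_le (min_le_right _ _)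
    have hth : 0 < t₀ + h := by positivity
    have hI1 := (integral_rlKernel_mul_mlKernel hρ Λ hth (sub_pos.2 hρ₁)).1
    have hI0 := (integral_rlKernel_mul_mlKernel hρ Λ ht₀ (sub_pos.2 hρ₁)).1
    rw [← he] at hI1 hI0
    have hI1a : IntervalIntegrable (fun s => rlKernel (1 - ρ) (t₀ + h - s) * e s) volume 0 t₀ :=
      hI1.mono_set (by rw [uIcc_of_le ht₀.le, uIcc_of_le hth.le]; exact Icc_subset_Icc_right (by linarith))
    have hI1b : IntervalIntegrable (fun s => rlKernel (1 - ρ) (t₀ + h - s) * e s) volume t₀ (t₀ + h) :=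
      hI1.mono_set (by
        rw [uIcc_of_le (by linarith), uIcc_of_le hth.le]; exact Icc_subset_Icc_left ht₀.le)
    rw [← integral_rlKernel_mul_mlKernel_eq_mlRelax hρ Λ hth hρ₁,
      ← integral_rlKernel_mul_mlKernel_eq_mlRelax hρ Λ ht₀ hρ₁, ← he,
      ← intervalIntegral.integral_add_adjacent_intervals hI1a hI1b]
    -- Loss from the past.
    have hA : (∫ s in (0 : ℝ)..t₀, rlKernel (1 - ρ) (t₀ + h - s) * e s)
        - ∫ s in (0 : ℝ)..t₀, rlKernel (1 - ρ) (t₀ - s) * e s ≤ -(c * J) * h := by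
      rw [← intervalIntegral.integral_sub hI1a hI0, hJ,
        show -(c * ∫ s in (0 : ℝ)..t₀, e s) * h = (-c * h) * ∫ s in (0 : ℝ)..t₀, e s by ring,
        ← intervalIntegral.integral_const_mul]
      refine intervalIntegral.integral_mono_on_of_le_Ioo ht₀.le (hI1a.sub hI0)
        ((intervalIntegrable_mlKernel hρ Λ ht₀).const_mul _) fun s hs => ?_
      rw [← sub_mul]
      refine mul_le_mul_of_nonneg_right ?_ (hepos s hs).le
      have h1 := mul_le_rpow_neg_sub_rpow_neg hρ (sub_pos.2 hs.2) hh0.le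
      have h2 : (t₀ + 1) ^ (-ρ - 1) ≤ (t₀ - s + h) ^ (-ρ - 1) :=
        Real.rpow_le_rpow_of_nonpos (by linarith [hs.2]) (by linarith [hs.1]) (by linarith)
      simp only [rlKernel, hc]
      rw [show 1 - ρ - 1 = -ρ by ring, ← sub_div, show t₀ + h - s = t₀ - s + h by ring,
        ← neg_mul_eq_neg_mul, div_mul_eq_mul_div, ← neg_div]
      refine div_le_div_of_nonneg_right ?_ hΓ.le
      have h3 := mul_le_mul_of_nonneg_left h2 (by positivity : 0 ≤ ρ * h)
      linarith
    -- Gain from the new interval: `e` is at most `|L| h` and the kernel has integral of order `h ^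
    -- (1 - ρ)`.
    have hB : ∫ s in t₀..(t₀ + h), rlKernel (1 - ρ) (t₀ + h - s) * e s
        ≤ |L| / Real.Gamma (1 - ρ) / (1 - ρ) * h ^ (1 - ρ) * h := by
      have hint : IntervalIntegrable (fun s : ℝ => (t₀ + h - s) ^ (-ρ)) volume t₀ (t₀ + h) := by
        have := (intervalIntegral.intervalIntegrable_rpow' (a := h) (b := 0)
          (by linarith : -1 < -ρ)).comp_sub_left (t₀ + h)
        simpa using this
      have hval : ∫ s in t₀..(t₀ + h), (t₀ + h - s) ^ (-ρ) = h ^ (1 - ρ) / (1 - ρ) := by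
        rw [intervalIntegral.integral_comp_sub_left (fun s => s ^ (-ρ)),
          integral_rpow (Or.inl (by linarith))]
        simp [show -ρ + 1 = 1 - ρ by ring, Real.zero_rpow (sub_pos.2 hρ₁).ne']
      calc ∫ s in t₀..(t₀ + h), rlKernel (1 - ρ) (t₀ + h - s) * e s
          ≤ ∫ s in t₀..(t₀ + h), |L| * h / Real.Gamma (1 - ρ) * (t₀ + h - s) ^ (-ρ) := by
            refine intervalIntegral.integral_mono_on (by linarith) hI1b (hint.const_mul _)
              fun s hs => ?_
            have h1 : e s ≤ |L| * h := by
              have h2 := hLδ (y := s) (by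
                rw [Real.dist_eq, abs_of_nonneg (by linarith [hs.1])]; linarith [hs.2])
              rw [← he, het₀, sub_zero, Real.norm_eq_abs, Real.norm_eq_abs,
                abs_of_nonneg (by linarith [hs.1] : 0 ≤ s - t₀)] at h2
              calc e s ≤ |e s| := le_abs_self _
                _ ≤ L * (s - t₀) := h2
                _ ≤ |L| * h := mul_le_mul (le_abs_self _) (by linarith [hs.2])
                  (by linarith [hs.1]) (abs_nonneg _)
            have h3 := mul_le_mul_of_nonneg_left h1
              (rlKernel_nonneg (sub_pos.2 hρ₁) (by linarith [hs.2] : 0 ≤ t₀ + h - s))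
            refine h3.trans (le_of_eq ?_)
            rw [rlKernel, show 1 - ρ - 1 = -ρ by ring]
            ring
        _ = |L| / Real.Gamma (1 - ρ) / (1 - ρ) * h ^ (1 - ρ) * h := by
            rw [intervalIntegral.integral_const_mul, hval]
            ring
    rw [smul_eq_mul, inv_mul_le_iff₀ hh0]
    linarith
  have hlim : Tendsto (fun h : ℝ => -(c * J) + |L| / Real.Gamma (1 - ρ) / (1 - ρ) * h ^ (1 - ρ))
      (𝓝[>] 0) (𝓝 (-(c * J))) := by
    have : Tendsto (fun h : ℝ => h ^ (1 - ρ)) (𝓝[>] 0) (𝓝 0) := by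
      have := (Real.continuous_rpow_const (sub_pos.2 hρ₁).le).tendsto (0 : ℝ)
      rw [Real.zero_rpow (sub_pos.2 hρ₁).ne'] at this
      exact this.mono_left nhdsWithin_le_nhds
    simpa using (this.const_mul (|L| / Real.Gamma (1 - ρ) / (1 - ρ))).const_add (-(c * J))
  have := le_of_tendsto_of_tendsto hder' hlim hkey
  have : 0 < c * J := by positivity
  linarith

theorem mittagLeffler_one_one (z : ℝ) : mittagLeffler 1 1 z = Real.exp z := by
  rw [Real.exp_eq_exp_ℝ, NormedSpace.exp_eq_tsum_div]
  simp [mittagLeffler, Real.Gamma_nat_eq_factorial]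

theorem mlKernel_pos {ρ Λ t : ℝ} (hρ : 0 < ρ) (hρ₁ : ρ ≤ 1) (ht : 0 < t) :
    0 < mlKernel ρ Λ t := by
  rcases hρ₁.lt_or_eq with h | rfl
  · exact mlKernel_pos_of_lt_one hρ h ht
  · rw [mlKernel, mittagLeffler_one_one]
    positivity

theorem mlRelax_nonneg {ρ Λ t : ℝ} (hρ : 0 < ρ) (hρ₁ : ρ ≤ 1) (ht : 0 < t) :
    0 ≤ mlRelax ρ Λ t := by
  rcases hρ₁.lt_or_eq with h | rfl
  · rw [← integral_rlKernel_mul_mlKernel_eq_mlRelax hρ Λ ht h, intervalIntegral.integral_of_le ht.le]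
    exact setIntegral_nonneg measurableSet_Ioc fun s hs =>
      mul_nonneg (rlKernel_nonneg (sub_pos.2 h) (sub_nonneg.2 hs.2))
        (mlKernel_pos hρ hρ₁ hs.1).le
  · rw [mlRelax, mittagLeffler_one_one]
    positivity

theorem integral_mlKernel_nonneg {ρ Λ t : ℝ} (hρ : 0 < ρ) (hρ₁ : ρ ≤ 1) (ht : 0 ≤ t) :
    0 ≤ ∫ s in (0 : ℝ)..t, mlKernel ρ Λ s := by
  rw [intervalIntegral.integral_of_le ht]
  exact setIntegral_nonneg measurableSet_Ioc fun s hs => (mlKernel_pos hρ hρ₁ hs.1).le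

/-! ### Kernel bounds uniform in `Λ` -/

section Bounds

variable {ρ Λ t : ℝ} (hρ : 0 < ρ) (hρ₁ : ρ ≤ 1) (hΛ : 0 ≤ Λ) (ht : 0 < t)
include hρ hρ₁ hΛ ht

theorem mlRelax_le_one : mlRelax ρ Λ t ≤ 1 := by
  rw [mlRelax_eq_one_sub_integral hρ Λ ht]
  linarith [mul_nonneg hΛ (integral_mlKernel_nonneg (Λ := Λ) hρ hρ₁ ht.le)]

/-- The convolution term in the resolvent equation is nonnegative and can be dropped. -/
theorem mlKernel_le_rlKernel : mlKernel ρ Λ t ≤ rlKernel ρ t := by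
  rw [← mlKernel_add_integral hρ Λ ht, intervalIntegral.integral_of_le ht.le]
  refine le_add_of_nonneg_right (mul_nonneg hΛ (setIntegral_nonneg measurableSet_Ioc fun s hs => ?_))
  exact mul_nonneg (rlKernel_nonneg hρ (sub_nonneg.2 hs.2)) (mlKernel_pos hρ hρ₁ hs.1).le

/-- Dropping the convolution in `mul_mlKernel_add_integral` leaves `t e_Λ(t) ≤ ρ ∫ e_Λ`, and `Λ ∫
e_Λ = 1 - r_Λ ≤ 1`. -/
theorem mul_mul_mlKernel_le_one : Λ * (t * mlKernel ρ Λ t) ≤ 1 := by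
  have h1 : t * mlKernel ρ Λ t ≤ ρ * ∫ s in (0 : ℝ)..t, mlKernel ρ Λ s := by
    rw [← mul_mlKernel_add_integral hρ Λ ht, intervalIntegral.integral_of_le ht.le]
    refine le_add_of_nonneg_right
      (mul_nonneg hΛ (setIntegral_nonneg measurableSet_Ioc fun s hs => ?_))
    exact mul_nonneg (rlKernel_nonneg hρ (sub_nonneg.2 hs.2))
      (mul_nonneg hs.1.le (mlKernel_pos hρ hρ₁ hs.1).le)
  have h2 : Λ * ∫ s in (0 : ℝ)..t, mlKernel ρ Λ s ≤ 1 := by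
    linarith [mlRelax_eq_one_sub_integral hρ Λ ht, mlRelax_nonneg (Λ := Λ) hρ hρ₁ ht]
  have h3 := mul_le_mul_of_nonneg_left h1 hΛ
  have h4 := mul_le_mul_of_nonneg_left h2 hρ.le
  linarith

/-- Geometric interpolation: the power `1 - ε` of `Λ t e_Λ ≤ 1` times the power `ε` of `e_Λ ≤ t ^ (ρ
- 1) / Γ(ρ)`. Any `ε > 0` makes the right side integrable at `0`. -/
theorem rpow_mul_mlKernel_le {ε : ℝ} (hε : 0 < ε) (hε₁ : ε < 1) :
    Λ ^ (1 - ε) * mlKernel ρ Λ t ≤ (Real.Gamma ρ)⁻¹ ^ ε * t ^ (ε * ρ - 1) := by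
  have he := (mlKernel_pos (Λ := Λ) hρ hρ₁ ht).le
  have hΓ : 0 < (Real.Gamma ρ)⁻¹ := inv_pos.2 (Real.Gamma_pos_of_pos hρ)
  have h1 : (Λ * (t * mlKernel ρ Λ t)) ^ (1 - ε) ≤ 1 :=
    Real.rpow_le_one (mul_nonneg hΛ (mul_nonneg ht.le he))
      (mul_mul_mlKernel_le_one hρ hρ₁ hΛ ht) (by linarith)
  rw [Real.mul_rpow hΛ (mul_nonneg ht.le he), Real.mul_rpow ht.le he] at h1
  have h2 : mlKernel ρ Λ t ^ ε ≤ (Real.Gamma ρ)⁻¹ ^ ε * t ^ ((ρ - 1) * ε) := by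
    refine (Real.rpow_le_rpow he (mlKernel_le_rlKernel hρ hρ₁ hΛ ht) hε.le).trans (le_of_eq ?_)
    rw [rlKernel, div_eq_mul_inv, Real.mul_rpow (by positivity) hΓ.le, ← Real.rpow_mul ht.le,
      mul_comm]
  have h3 : mlKernel ρ Λ t = mlKernel ρ Λ t ^ (1 - ε) * mlKernel ρ Λ t ^ ε := by
    rw [← Real.rpow_add (mlKernel_pos hρ hρ₁ ht)]; simp
  have h4 : t ^ (ε * ρ - 1) = t ^ ((ρ - 1) * ε) * t ^ (-(1 - ε)) := by
    rw [← Real.rpow_add ht]; ring_nf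
  have h5 : t ^ (1 - ε) * t ^ (-(1 - ε)) = 1 := by
    rw [← Real.rpow_add ht]; simp
  calc Λ ^ (1 - ε) * mlKernel ρ Λ t
      = (Λ ^ (1 - ε) * (t ^ (1 - ε) * mlKernel ρ Λ t ^ (1 - ε))) * t ^ (-(1 - ε))
          * mlKernel ρ Λ t ^ ε := by
        nth_rewrite 1 [h3]
        linear_combination (-(Λ ^ (1 - ε) * mlKernel ρ Λ t ^ (1 - ε) * mlKernel ρ Λ t ^ ε)) * h5
    _ ≤ 1 * t ^ (-(1 - ε)) * ((Real.Gamma ρ)⁻¹ ^ ε * t ^ ((ρ - 1) * ε)) := by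
        gcongr
    _ = _ := by rw [h4]; ring

end Bounds

/-! ### Causal convolution on a bounded interval -/

section Convolution

variable {E : Type*} [NormedAddCommGroup E] [NormedSpace ℝ E] [CompleteSpace E]

/-- The causal convolution `∫_0^t κ(ξ) f(t - ξ) dξ`. -/
def causalConv (κ : ℝ → ℝ) (f : ℝ → E) (t : ℝ) : E := ∫ ξ in (0 : ℝ)..t, κ ξ • f (t - ξ)

-- Truncation to `(0, t]` makes the factors integrable on the line without changing their causal
-- convolution up to time `t`. The product is supported on the open interval `(0, s)`.
omit [CompleteSpace E] in
theorem convolution_indicator_apply (κ : ℝ → ℝ) (f : ℝ → E) {s t : ℝ} (hs : 0 ≤ s) (hst : s ≤ t) :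
    convolution (indicator (Ioc 0 t) κ) (indicator (Ioc 0 t) f) (ContinuousLinearMap.lsmul ℝ ℝ)
      volume s = causalConv κ f s := by
  rw [convolution, causalConv, intervalIntegral.integral_of_le hs, integral_Ioc_eq_integral_Ioo,
    ← integral_indicator measurableSet_Ioo]
  congr 1 with x
  simp only [ContinuousLinearMap.lsmul_apply, indicator, mem_Ioc, mem_Ioo]
  by_cases hx : 0 < x ∧ x < s
  · rw [if_pos ⟨hx.1, by linarith⟩, if_pos ⟨by linarith, by linarith⟩, if_pos hx]
  · rw [if_neg hx]
    by_cases h1 : 0 < x ∧ x ≤ t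
    · rw [if_neg (c := 0 < s - x ∧ s - x ≤ t) (fun h => hx ⟨h1.1, by linarith [h.1]⟩), smul_zero]
    · rw [if_neg h1, zero_smul]

omit [CompleteSpace E] in
theorem intervalIntegrable_smul_comp_sub {κ : ℝ → ℝ} {f : ℝ → E} {s t : ℝ}
    (h : IntervalIntegrable κ volume 0 t) (hf : Continuous f) :
    IntervalIntegrable (fun ξ => κ ξ • f (s - ξ)) volume 0 t :=
  h.smul_continuousOn (hf.comp (continuous_const.sub continuous_id)).continuousOn

/-- Associativity of convolution for the truncated functions, evaluated at the single point `t`. -/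
theorem causalConv_causalConv {κ₁ κ₂ : ℝ → ℝ} {f : ℝ → E} {t : ℝ} (ht : 0 ≤ t)
    (h₁ : IntervalIntegrable κ₁ volume 0 t) (h₂ : IntervalIntegrable κ₂ volume 0 t)
    (hf : Continuous f) :
    causalConv κ₁ (causalConv κ₂ f) t = causalConv (causalConv κ₁ κ₂) f t := by
  set a := indicator (Ioc 0 t) κ₁ with ha
  set b := indicator (Ioc 0 t) κ₂ with hb
  set g := indicator (Ioc 0 t) f with hg
  have hai : Integrable a :=
    (integrable_indicator_iff measurableSet_Ioc).2
      ((intervalIntegrable_iff_integrableOn_Ioc_of_le ht).1 h₁)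
  have hbi : Integrable b :=
    (integrable_indicator_iff measurableSet_Ioc).2
      ((intervalIntegrable_iff_integrableOn_Ioc_of_le ht).1 h₂)
  have hgi : Integrable g :=
    (integrable_indicator_iff measurableSet_Ioc).2
      ((intervalIntegrable_iff_integrableOn_Ioc_of_le ht).1 (hf.intervalIntegrable 0 t))
  obtain ⟨M, hM⟩ := isCompact_Icc.exists_bound_of_continuousOn (s := Icc 0 t) hf.continuousOn
  have hM0 : 0 ≤ M := (norm_nonneg _).trans (hM 0 ⟨le_rfl, ht⟩)
  have hgM : ∀ x, ‖g x‖ ≤ M := fun x => by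
    by_cases hx : x ∈ Ioc 0 t
    · rw [hg, indicator_of_mem hx]; exact hM x (Ioc_subset_Icc_self hx)
    · rw [hg, indicator_of_notMem hx, norm_zero]; exact hM0
  have key := convolution_assoc (μ := volume) (ν := volume) (f := a) (g := b) (k := g) (x₀ := t)
    (ContinuousLinearMap.lsmul ℝ ℝ) (ContinuousLinearMap.lsmul ℝ ℝ)
    (ContinuousLinearMap.lsmul ℝ ℝ) (ContinuousLinearMap.lsmul ℝ ℝ)
    (fun x y z => by simp only [ContinuousLinearMap.lsmul_apply, smul_eq_mul, mul_smul])
    hai.aestronglyMeasurable hbi.aestronglyMeasurable hgi.aestronglyMeasurable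
    (hai.ae_convolution_exists _ hbi) (hbi.norm.ae_convolution_exists _ hgi.norm) ?_
  · have hr : convolution a (convolution b g (ContinuousLinearMap.lsmul ℝ ℝ) volume)
        (ContinuousLinearMap.lsmul ℝ ℝ) volume t = causalConv κ₁ (causalConv κ₂ f) t := by
      rw [convolution, causalConv, intervalIntegral.integral_of_le ht,
        ← integral_indicator measurableSet_Ioc]
      congr 1 with x
      by_cases hx : x ∈ Ioc 0 t
      · rw [indicator_of_mem hx, ha, indicator_of_mem hx, ContinuousLinearMap.lsmul_apply,
          convolution_indicator_apply κ₂ f (by linarith [hx.2]) (by linarith [hx.1])]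
      · rw [indicator_of_notMem hx, ha, indicator_of_notMem hx]
        simp
    have hl : convolution (convolution a b (ContinuousLinearMap.lsmul ℝ ℝ) volume) g
        (ContinuousLinearMap.lsmul ℝ ℝ) volume t = causalConv (causalConv κ₁ κ₂) f t := by
      -- Here the truncated factor is evaluated at `t - x`, and `t - x ∈ (0, t]` means `x ∈ [0, t)`.
      rw [convolution, causalConv, intervalIntegral.integral_of_le ht, integral_Ioc_eq_integral_Ioo,
        ← integral_Ico_eq_integral_Ioo, ← integral_indicator measurableSet_Ico]
      congr 1 with x
      by_cases hx : x ∈ Ico 0 t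
      · rw [indicator_of_mem hx, hg, indicator_of_mem (by
          rw [mem_Ioc]; constructor <;> linarith [hx.1, hx.2]), ContinuousLinearMap.lsmul_apply,
          convolution_indicator_apply κ₁ κ₂ hx.1 hx.2.le]
      · rw [indicator_of_notMem hx, hg, indicator_of_notMem (fun h => hx ⟨by linarith [h.2],
          by linarith [h.1]⟩)]
        simp
    rw [← hr, ← hl, key]
  -- Boundedness of `g` bounds `‖b‖ * ‖g‖` everywhere, so the triple convolution exists at this
  -- particular `t`, not merely almost everywhere.
  · have hbg : Integrable (convolution (fun x => ‖b x‖) (fun x => ‖g x‖)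
        (ContinuousLinearMap.mul ℝ ℝ) volume) := hbi.norm.integrable_convolution _ hgi.norm
    have hbd : ∀ x, ‖convolution (fun x => ‖b x‖) (fun x => ‖g x‖)
        (ContinuousLinearMap.mul ℝ ℝ) volume x‖ ≤ (∫ y, ‖b y‖) * M := fun x => by
      rw [convolution, ← integral_mul_const]
      refine norm_integral_le_of_norm_le (hbi.norm.mul_const M) (Eventually.of_forall fun y => ?_)
      simp only [ContinuousLinearMap.mul_apply', norm_mul, norm_norm]
      gcongr
      exact hgM _
    have := hai.norm.mul_bdd (g := fun s => convolution (fun x => ‖b x‖) (fun x => ‖g x‖)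
        (ContinuousLinearMap.mul ℝ ℝ) volume (t - s)) (c := (∫ y, ‖b y‖) * M)
        (hbg.comp_sub_left t).aestronglyMeasurable (Eventually.of_forall fun s => hbd _)
    exact this

/-- Subtracting `f 0` and freezing the argument at negative times makes the integrand vanish beyond
`ξ = t`. The upper limit can then be fixed at `T`, and dominated convergence applies. The subtracted
part is a primitive of `κ` times `f 0`. -/
theorem continuousOn_causalConv {κ : ℝ → ℝ} {f : ℝ → E} {T : ℝ} (hT : 0 ≤ T)
    (hκ : IntervalIntegrable κ volume 0 T) (hf : Continuous f) {M : ℝ} (hM : ∀ s, ‖f s‖ ≤ M) :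
    ContinuousOn (causalConv κ f) (Icc 0 T) := by
  set g : ℝ → E := fun s => f (max s 0) - f 0 with hg
  have hgc : Continuous g := (hf.comp (continuous_id.max continuous_const)).sub continuous_const
  have hgM : ∀ s, ‖g s‖ ≤ M + M := fun s =>
    (norm_sub_le _ _).trans (add_le_add (hM _) (hM _))
  have h1 : Continuous fun t => ∫ ξ in (0 : ℝ)..T, κ ξ • g (t - ξ) := by
    refine intervalIntegral.continuous_of_dominated_interval
      (bound := fun ξ => ‖κ ξ‖ * (M + M)) (fun t => ?_) (fun t => ?_) (hκ.norm.mul_const _) ?_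
    · rw [uIoc_of_le hT]
      exact (intervalIntegrable_smul_comp_sub hκ hgc).1.aestronglyMeasurable
    · refine Eventually.of_forall fun ξ _ => ?_
      rw [norm_smul]
      gcongr
      exact hgM _
    · exact Eventually.of_forall fun ξ _ => by fun_prop
  have h2 : ContinuousOn (fun t => ∫ ξ in (0 : ℝ)..t, κ ξ) (Icc 0 T) := by
    have := intervalIntegral.continuousOn_primitive_interval (f := κ) (a := 0) (b := T)
      (μ := volume) (by rwa [uIcc_of_le hT, ← intervalIntegrable_iff_integrableOn_Icc_of_le hT])
    rwa [uIcc_of_le hT] at this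
  refine (h1.continuousOn.add (h2.smul continuousOn_const (g := fun _ => f 0))).congr fun t ht => ?_
  have hκt : IntervalIntegrable κ volume 0 t :=
    hκ.mono_set (by rw [uIcc_of_le ht.1, uIcc_of_le hT]; exact Icc_subset_Icc_right ht.2)
  have hκt' : IntervalIntegrable κ volume t T :=
    hκ.mono_set (by rw [uIcc_of_le ht.2, uIcc_of_le hT]; exact Icc_subset_Icc_left ht.1)
  have h3 : ∫ ξ in t..T, κ ξ • g (t - ξ) = 0 := by
    rw [intervalIntegral.integral_congr (g := fun _ => (0 : E)) fun ξ hξ => ?_]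
    · simp
    · rw [uIcc_of_le ht.2] at hξ
      simp only [hg]
      rw [max_eq_right (by linarith [hξ.1]), sub_self, smul_zero]
  have hadj := intervalIntegral.integral_add_adjacent_intervals
    (intervalIntegrable_smul_comp_sub (s := t) hκt hgc)
    (hκt'.smul_continuousOn (hgc.comp (continuous_const.sub continuous_id)).continuousOn :
      IntervalIntegrable (fun ξ => κ ξ • g (t - ξ)) volume t T)
  change ∫ ξ in (0 : ℝ)..t, κ ξ • f (t - ξ)
    = (∫ ξ in (0 : ℝ)..T, κ ξ • g (t - ξ)) + (∫ ξ in (0 : ℝ)..t, κ ξ) • f 0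
  rw [← hadj, h3, add_zero, ← intervalIntegral.integral_smul_const,
    ← intervalIntegral.integral_add (intervalIntegrable_smul_comp_sub hκt hgc)
      (hκt.smul_continuousOn continuousOn_const)]
  refine intervalIntegral.integral_congr fun ξ hξ => ?_
  rw [uIcc_of_le ht.1] at hξ
  simp only [hg]
  rw [max_eq_left (by linarith [hξ.2]), ← smul_add, sub_add_cancel]

omit [CompleteSpace E] in
theorem integral_comp_sub_smul (κ : ℝ → ℝ) (f : ℝ → E) (t : ℝ) :
    ∫ s in (0 : ℝ)..t, κ (t - s) • f s = causalConv κ f t := by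
  have := intervalIntegral.integral_comp_sub_left (fun s => κ s • f (t - s)) t (a := 0) (b := t)
  simpa [causalConv] using this

end Convolution

/-! ### The Duhamel term and its fractional integral -/

section Duhamel

variable {E : Type*} [NormedAddCommGroup E] [NormedSpace ℝ E] [CompleteSpace E]
  {ρ : ℝ} (hρ : 0 < ρ) (Λ : ℝ)

theorem intervalIntegrable_rlKernel {b : ℝ} (hb : 0 < b) (t : ℝ) :
    IntervalIntegrable (rlKernel b) volume 0 t :=
  (intervalIntegral.intervalIntegrable_rpow' (by linarith)).div_const _

include hρ

theorem continuous_mlRelax : Continuous (mlRelax ρ Λ) :=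
  (differentiable_mittagLeffler hρ 1).continuous.comp
    (continuous_const.mul (Real.continuous_rpow_const hρ.le))

theorem mlRelax_zero : mlRelax ρ Λ 0 = 1 := by
  simp only [mlRelax, mittagLeffler, Real.zero_rpow hρ.ne', mul_zero]
  rw [tsum_eq_single 0 (fun k hk => by simp [hk])]
  simp

theorem causalConv_rlKernel_mlKernel (hρ₁ : ρ < 1) {t : ℝ} (ht : 0 < t) :
    causalConv (rlKernel (1 - ρ)) (mlKernel ρ Λ) t = mlRelax ρ Λ t := by
  rw [← integral_comp_sub_smul]
  exact integral_rlKernel_mul_mlKernel_eq_mlRelax hρ Λ ht hρ₁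

theorem causalConv_rlKernel_causalConv_mlKernel (hρ₁ : ρ < 1) {f : ℝ → E} (hf : Continuous f)
    {t : ℝ} (ht : 0 < t) :
    causalConv (rlKernel (1 - ρ)) (causalConv (mlKernel ρ Λ) f) t
      = causalConv (mlRelax ρ Λ) f t := by
  rw [causalConv_causalConv ht.le (intervalIntegrable_rlKernel (sub_pos.2 hρ₁) t)
    (intervalIntegrable_mlKernel hρ Λ ht) hf]
  refine intervalIntegral.integral_congr_ae (Eventually.of_forall fun ξ hξ => ?_)
  rw [uIoc_of_le ht.le] at hξ
  rw [causalConv_rlKernel_mlKernel hρ Λ hρ₁ hξ.1]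

theorem continuousOn_causalConv_mlKernel {f : ℝ → E} (hf : Continuous f) {M : ℝ}
    (hM : ∀ s, ‖f s‖ ≤ M) {T : ℝ} (hT : 0 < T) :
    ContinuousOn (causalConv (mlKernel ρ Λ) f) (Icc 0 T) :=
  continuousOn_causalConv hT.le (intervalIntegrable_mlKernel hρ Λ hT) hf hM

/-- Convolving `r_Λ = 1 - Λ (1 * e_Λ)` with `f` and using associativity writes `r_Λ * f` as the
primitive of a continuous function. Its derivative then follows from the fundamental theorem, with
no differentiation of the singular kernel. -/
theorem causalConv_mlRelax {f : ℝ → E} (hf : Continuous f) {M : ℝ} (hM : ∀ s, ‖f s‖ ≤ M)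
    {t : ℝ} (ht : 0 < t) :
    causalConv (mlRelax ρ Λ) f t
      = ∫ s in (0 : ℝ)..t, (f s - Λ • causalConv (mlKernel ρ Λ) f s) := by
  have hc := continuousOn_causalConv_mlKernel hρ Λ hf hM ht
  have hci : IntervalIntegrable (causalConv (mlKernel ρ Λ) f) volume 0 t :=
    ContinuousOn.intervalIntegrable (by rwa [uIcc_of_le ht.le])
  have h1 := causalConv_causalConv (κ₁ := fun _ => 1) ht.le intervalIntegrable_const
    (intervalIntegrable_mlKernel hρ Λ ht) hf
  have h2 : causalConv (fun _ => 1) (causalConv (mlKernel ρ Λ) f) t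
      = ∫ s in (0 : ℝ)..t, causalConv (mlKernel ρ Λ) f s := by
    rw [← integral_comp_sub_smul]; simp
  have h3 : ∫ s in (0 : ℝ)..t, f s = ∫ ξ in (0 : ℝ)..t, f (t - ξ) := by
    simp
  have h4 : ∫ s in (0 : ℝ)..t, (f s - Λ • causalConv (mlKernel ρ Λ) f s)
      = (∫ s in (0 : ℝ)..t, f s) - ∫ s in (0 : ℝ)..t, Λ • causalConv (mlKernel ρ Λ) f s :=
    intervalIntegral.integral_sub (hf.intervalIntegrable 0 t) (hci.smul Λ)
  rw [h4, intervalIntegral.integral_smul, ← h2, h1, h3, causalConv, causalConv,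
    ← intervalIntegral.integral_smul, ← intervalIntegral.integral_sub]
  · refine intervalIntegral.integral_congr_ae (Eventually.of_forall fun ξ hξ => ?_)
    rw [uIoc_of_le ht.le] at hξ
    rw [mlRelax_eq_one_sub_integral hρ Λ hξ.1, ← integral_comp_sub_smul]
    simp [sub_smul, mul_smul]
  · exact (hf.comp (continuous_const.sub continuous_id)).intervalIntegrable _ _
  · refine IntervalIntegrable.smul (intervalIntegrable_smul_comp_sub ?_ hf) Λ
    refine ContinuousOn.intervalIntegrable ?_
    rw [uIcc_of_le ht.le]
    have : causalConv (fun _ => (1 : ℝ)) (mlKernel ρ Λ)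
        = fun x => ∫ s in (0 : ℝ)..x, mlKernel ρ Λ s := by
      ext x; rw [← integral_comp_sub_smul]; simp
    rw [this]
    have := intervalIntegral.continuousOn_primitive_interval (f := mlKernel ρ Λ) (a := 0) (b := t)
      (μ := volume) (by
        rw [uIcc_of_le ht.le, ← intervalIntegrable_iff_integrableOn_Icc_of_le ht.le]
        exact intervalIntegrable_mlKernel hρ Λ ht)
    rwa [uIcc_of_le ht.le] at this

theorem hasDerivAt_causalConv_mlRelax {f : ℝ → E} (hf : Continuous f) {M : ℝ}
    (hM : ∀ s, ‖f s‖ ≤ M) {t : ℝ} (ht : 0 < t) :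
    HasDerivAt (causalConv (mlRelax ρ Λ) f) (f t - Λ • causalConv (mlKernel ρ Λ) f t) t := by
  have hc : ContinuousOn (fun s => f s - Λ • causalConv (mlKernel ρ Λ) f s) (Icc 0 (t + 1)) :=
    hf.continuousOn.sub ((continuousOn_causalConv_mlKernel hρ Λ hf hM (by positivity)).const_smul Λ)
  have hn : Icc 0 (t + 1) ∈ 𝓝 t := Icc_mem_nhds ht (by linarith)
  have h : HasDerivAt (fun t => ∫ s in (0 : ℝ)..t, (f s - Λ • causalConv (mlKernel ρ Λ) f s))
      (f t - Λ • causalConv (mlKernel ρ Λ) f t) t := by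
    refine intervalIntegral.integral_hasDerivAt_right ?_ ?_ (hc.continuousAt hn)
    · refine ContinuousOn.intervalIntegrable (hc.mono ?_)
      rw [uIcc_of_le ht.le]
      exact Icc_subset_Icc_right (by linarith)
    · exact (hc.mono Ioo_subset_Icc_self).stronglyMeasurableAtFilter isOpen_Ioo t
        ⟨ht, by linarith⟩
  refine h.congr_of_eventuallyEq ?_
  filter_upwards [Ioi_mem_nhds ht] with s hs
  exact causalConv_mlRelax hρ Λ hf hM hs

end Duhamel

/-! ### Absolute summability with uniformly small tails -/

/-- The tails of the series `∑ ‖h n x‖` are small uniformly in `x ∈ K`. -/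
def UnifSummableOn {ι X E : Type*} [NormedAddCommGroup E] (h : ι → X → E) (K : Set X) : Prop :=
  ∀ ε > 0, ∃ S : Finset ι, ∀ T : Finset ι, Disjoint T S → ∀ x ∈ K, ∑ n ∈ T, ‖h n x‖ ≤ ε

namespace UnifSummableOn

variable {ι X Y E F : Type*} [NormedAddCommGroup E] [NormedAddCommGroup F]
  {h g : ι → X → E} {K : Set X}

theorem mono (hh : UnifSummableOn h K) {K' : Set X} (hK : K' ⊆ K) : UnifSummableOn h K' :=
  fun ε hε => (hh ε hε).imp fun _ hS T hT x hx => hS T hT x (hK hx)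

theorem summable (hh : UnifSummableOn h K) {x : X} (hx : x ∈ K) : Summable fun n => ‖h n x‖ := by
  refine summable_iff_vanishing_norm.2 fun ε hε => ?_
  obtain ⟨S, hS⟩ := hh (ε / 2) (half_pos hε)
  refine ⟨S, fun T hT => ?_⟩
  rw [Real.norm_of_nonneg (Finset.sum_nonneg fun _ _ => norm_nonneg _)]
  linarith [hS T hT x hx]

theorem of_norm_le {q : ι → Y → F} {K' : Set Y} (hq : UnifSummableOn q K') (C : ℝ) (π : X → Y)
    (hπ : ∀ x ∈ K, π x ∈ K') (hle : ∀ n, ∀ x ∈ K, ‖h n x‖ ≤ C * ‖q n (π x)‖) :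
    UnifSummableOn h K := by
  intro ε hε
  obtain ⟨S, hS⟩ := hq (ε / (|C| + 1)) (by positivity)
  refine ⟨S, fun T hT x hx => ?_⟩
  calc ∑ n ∈ T, ‖h n x‖ ≤ ∑ n ∈ T, (|C| + 1) * ‖q n (π x)‖ :=
        Finset.sum_le_sum fun n _ => (hle n x hx).trans
          (mul_le_mul_of_nonneg_right (by linarith [le_abs_self C]) (norm_nonneg _))
    _ ≤ (|C| + 1) * (ε / (|C| + 1)) := by
        rw [← Finset.mul_sum]
        exact mul_le_mul_of_nonneg_left (hS T hT _ (hπ x hx)) (by positivity)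
    _ = ε := by field_simp

theorem add (hh : UnifSummableOn h K) (hg : UnifSummableOn g K) :
    UnifSummableOn (fun n x => h n x + g n x) K := by
  classical
  intro ε hε
  obtain ⟨S, hS⟩ := hh (ε / 2) (half_pos hε)
  obtain ⟨S', hS'⟩ := hg (ε / 2) (half_pos hε)
  refine ⟨S ∪ S', fun T hT x hx => ?_⟩
  rw [Finset.disjoint_union_right] at hT
  calc ∑ n ∈ T, ‖h n x + g n x‖ ≤ ∑ n ∈ T, (‖h n x‖ + ‖g n x‖) :=
        Finset.sum_le_sum fun n _ => norm_add_le _ _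
    _ ≤ ε := by
        rw [Finset.sum_add_distrib]
        linarith [hS T hT.1 x hx, hS' T hT.2 x hx]

theorem of_summable {a : ι → ℝ} (ha : Summable a) (hle : ∀ n, ∀ x ∈ K, ‖h n x‖ ≤ a n) :
    UnifSummableOn h K := by
  intro ε hε
  obtain ⟨S, hS⟩ := summable_iff_vanishing_norm.1 ha ε hε
  exact ⟨S, fun T hT x hx => (Finset.sum_le_sum fun n _ => hle n x hx).trans
    ((Real.le_norm_self _).trans (hS T hT).le)⟩

theorem tendstoUniformlyOn [CompleteSpace E] (hh : UnifSummableOn h K) :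
    TendstoUniformlyOn (fun (S : Finset ι) x => ∑ n ∈ S, h n x) (fun x => ∑' n, h n x) atTop K := by
  classical
  rw [Metric.tendstoUniformlyOn_iff]
  intro ε hε
  obtain ⟨S, hS⟩ := hh (ε / 2) (half_pos hε)
  filter_upwards [eventually_ge_atTop S] with T hT x hx
  have hlim : Tendsto (fun U : Finset ι => dist (∑ n ∈ U, h n x) (∑ n ∈ T, h n x)) atTop
      (𝓝 (dist (∑' n, h n x) (∑ n ∈ T, h n x))) :=
    (Summable.of_norm (hh.summable hx)).hasSum.dist tendsto_const_nhds
  refine (le_of_tendsto hlim ?_).trans_lt (half_lt_self hε)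
  filter_upwards [eventually_ge_atTop T] with U hU
  rw [dist_eq_norm, ← Finset.sum_sdiff hU, add_sub_cancel_right]
  exact (norm_sum_le _ _).trans (hS _ (Finset.disjoint_of_subset_right hT Finset.sdiff_disjoint) x hx)

theorem continuousOn_tsum [CompleteSpace E] [TopologicalSpace X] (hh : UnifSummableOn h K)
    (hc : ∀ n, ContinuousOn (h n) K) : ContinuousOn (fun x => ∑' n, h n x) K :=
  hh.tendstoUniformlyOn.continuousOn
    (Frequently.of_forall fun S => continuousOn_finsetSum S fun n _ => hc n)

/-- Causal convolution preserves uniform summability when the kernels are dominated. -/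
theorem causalConv [NormedSpace ℝ E] {κ : ι → ℝ → ℝ} {f : ι → ℝ → E} {q : ι → ℝ → F}
    (hq : UnifSummableOn q univ) {w : ℝ → ℝ} {T : ℝ} (hT : 0 ≤ T)
    (hw : IntervalIntegrable w volume 0 T) (hκ : ∀ n, IntervalIntegrable (κ n) volume 0 T)
    (hf : ∀ n, Continuous (f n))
    (hle : ∀ n, ∀ ξ ∈ Ioc 0 T, ∀ s, |κ n ξ| * ‖f n s‖ ≤ w ξ * ‖q n s‖)
    (hw0 : ∀ ξ ∈ Ioc 0 T, 0 ≤ w ξ) :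
    UnifSummableOn (fun n => TorusSubdiffusion.causalConv (κ n) (f n)) (Icc 0 T) := by
  intro ε hε
  have hI : 0 ≤ ∫ ξ in (0 : ℝ)..T, w ξ := by
    rw [intervalIntegral.integral_of_le hT]
    exact setIntegral_nonneg measurableSet_Ioc hw0
  set I := ∫ ξ in (0 : ℝ)..T, w ξ
  -- The added `1` covers the case `I = 0`.
  obtain ⟨S, hS⟩ := hq (ε / (I + 1)) (by positivity)
  refine ⟨S, fun U hU t ht => ?_⟩
  have hsub : uIcc 0 t ⊆ uIcc 0 T := by
    rw [uIcc_of_le ht.1, uIcc_of_le hT]; exact Icc_subset_Icc_right ht.2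
  have hint : ∀ n, IntervalIntegrable (fun ξ => |κ n ξ| * ‖f n (t - ξ)‖) volume 0 t := fun n => by
    have := intervalIntegrable_smul_comp_sub (s := t) ((hκ n).mono_set hsub) (hf n)
    simpa [norm_smul] using this.norm
  calc ∑ n ∈ U, ‖TorusSubdiffusion.causalConv (κ n) (f n) t‖
      ≤ ∑ n ∈ U, ∫ ξ in (0 : ℝ)..t, |κ n ξ| * ‖f n (t - ξ)‖ := by
        refine Finset.sum_le_sum fun n _ => ?_
        refine (intervalIntegral.norm_integral_le_integral_norm ht.1).trans (le_of_eq ?_)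
        simp [norm_smul]
    _ = ∫ ξ in (0 : ℝ)..t, ∑ n ∈ U, |κ n ξ| * ‖f n (t - ξ)‖ :=
        (intervalIntegral.integral_finsetSum fun n _ => hint n).symm
    -- The whole tail of `∑ ‖q n‖` is estimated at each time `t - ξ` under the integral, so no
    -- supremum over time is taken term by term.
    _ ≤ ∫ ξ in (0 : ℝ)..t, w ξ * (ε / (I + 1)) := by
        refine intervalIntegral.integral_mono_on_of_le_Ioo ht.1
          (by simpa only [Finset.sum_fn] using IntervalIntegrable.sum U fun n _ => hint n)
          ((hw.mono_set hsub).mul_const _) fun ξ hξ => ?_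
        have hξ' : ξ ∈ Ioc 0 T := ⟨hξ.1, by linarith [hξ.2, ht.2]⟩
        calc ∑ n ∈ U, |κ n ξ| * ‖f n (t - ξ)‖ ≤ ∑ n ∈ U, w ξ * ‖q n (t - ξ)‖ :=
              Finset.sum_le_sum fun n _ => hle n ξ hξ' _
          _ ≤ w ξ * (ε / (I + 1)) := by
              rw [← Finset.mul_sum]
              exact mul_le_mul_of_nonneg_left (hS U hU _ (mem_univ _)) (hw0 ξ hξ')
    _ = (∫ ξ in (0 : ℝ)..t, w ξ) * (ε / (I + 1)) := intervalIntegral.integral_mul_const _ _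
    _ ≤ I * (ε / (I + 1)) := by
        refine mul_le_mul_of_nonneg_right ?_ (by positivity)
        refine intervalIntegral.integral_mono_interval le_rfl ht.1 ht.2 ?_ hw
        exact (ae_restrict_iff' measurableSet_Ioc).2 (Eventually.of_forall hw0)
    _ ≤ ε := by
        rw [mul_div_assoc', div_le_iff₀ (by positivity)]
        nlinarith

end UnifSummableOn

/-! ### The scalar problem for one Fourier mode -/

theorem intervalIntegrable_rlKernel_smul {E : Type*} [NormedAddCommGroup E] [NormedSpace ℝ E]
    {b t : ℝ} (hb : 0 < b) (ht : 0 ≤ t) {g : ℝ → E} (hg : ContinuousOn g (Icc 0 t)) :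
    IntervalIntegrable (fun s => rlKernel b (t - s) • g s) volume 0 t := by
  have h : IntervalIntegrable (fun s => rlKernel b (t - s)) volume 0 t := by
    simpa using ((intervalIntegrable_rlKernel hb t).comp_sub_left t).symm
  exact h.smul_continuousOn (by rwa [uIcc_of_le ht])

theorem _root_.IntervalIntegrable.complexOfReal {g : ℝ → ℝ} {a b : ℝ}
    (h : IntervalIntegrable g volume a b) :
    IntervalIntegrable (fun s => (g s : ℂ)) volume a b :=
  ⟨h.1.ofReal, h.2.ofReal⟩

section Mode

/-- The coefficient `c e_Λ(t) + ∫_0^t e_Λ(ξ) f(t - ξ) dξ`, `e_Λ(t) = t ^ (ρ - 1) E_{ρ,ρ}(-Λ t ^ ρ)`,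
which solves the scalar fractional relaxation equation. -/
def mode (ρ Λ : ℝ) (c : ℂ) (f : ℝ → ℂ) (t : ℝ) : ℂ :=
  c * (mlKernel ρ Λ t : ℂ) + causalConv (mlKernel ρ Λ) f t

/-- The Riemann–Liouville integral of order `1 - ρ` of `mode ρ Λ c f`. -/
def modeInt (ρ Λ : ℝ) (c : ℂ) (f : ℝ → ℂ) (t : ℝ) : ℂ :=
  c * (mlRelax ρ Λ t : ℂ) + causalConv (mlRelax ρ Λ) f t

variable {ρ : ℝ} (hρ : 0 < ρ) (Λ : ℝ) (c : ℂ) {f : ℝ → ℂ} (hf : Continuous f) {M : ℝ}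
  (hM : ∀ s, ‖f s‖ ≤ M)

include hρ in
theorem modeInt_zero : modeInt ρ Λ c f 0 = c := by
  simp [modeInt, mlRelax_zero hρ, causalConv]

include hρ hf hM

theorem continuousOn_modeInt {T : ℝ} (hT : 0 ≤ T) : ContinuousOn (modeInt ρ Λ c f) (Icc 0 T) := by
  have hc := continuous_mlRelax hρ Λ
  exact (by fun_prop : Continuous fun t => c * (mlRelax ρ Λ t : ℂ)).continuousOn.add
    (continuousOn_causalConv hT (hc.intervalIntegrable 0 T) hf hM)

theorem continuousOn_mode : ContinuousOn (mode ρ Λ c f) (Ioi 0) := by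
  intro t ht
  have h1 : ContinuousAt (mlKernel ρ Λ) t :=
    ((differentiableOn_mlKernel hρ Λ).differentiableAt (Ioi_mem_nhds ht)).continuousAt
  have h2 : ContinuousAt (causalConv (mlKernel ρ Λ) f) t :=
    (continuousOn_causalConv_mlKernel hρ Λ hf hM (add_pos ht one_pos)).continuousAt
      (Icc_mem_nhds ht (by simp))
  exact ((continuousAt_const.mul (Complex.continuous_ofReal.continuousAt.comp h1)).add
    h2).continuousWithinAt

theorem hasDerivAt_modeInt {t : ℝ} (ht : 0 < t) :
    HasDerivAt (modeInt ρ Λ c f) (f t - Λ * mode ρ Λ c f t) t := by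
  have h1 := ((hasDerivAt_mlRelax hρ Λ ht).ofReal_comp.const_mul c)
  refine (h1.add (hasDerivAt_causalConv_mlRelax hρ Λ hf hM ht)).congr_deriv ?_
  rw [mode, Complex.real_smul]
  push_cast
  ring

theorem intervalIntegrable_rlKernel_smul_mode (hρ₁ : ρ < 1) {t : ℝ} (ht : 0 < t) :
    IntervalIntegrable (fun s => rlKernel (1 - ρ) (t - s) • mode ρ Λ c f s) volume 0 t := by
  have h1 := (integral_rlKernel_mul_mlKernel hρ Λ ht (sub_pos.2 hρ₁)).1
  have h3 : IntervalIntegrable (fun s => rlKernel (1 - ρ) (t - s) • causalConv (mlKernel ρ Λ) f s)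
      volume 0 t := intervalIntegrable_rlKernel_smul (sub_pos.2 hρ₁) ht.le
    (continuousOn_causalConv_mlKernel hρ Λ hf hM ht)
  refine (h1.complexOfReal.const_mul c |>.add h3).congr fun s _ => ?_
  simp only [mode, Complex.real_smul]
  push_cast
  ring

/-- Fractional integration turns `e_Λ` into `r_Λ` in both summands, in the Duhamel term by
associativity. -/
theorem integral_rlKernel_smul_mode (hρ₁ : ρ < 1) {t : ℝ} (ht : 0 < t) :
    ∫ s in (0 : ℝ)..t, rlKernel (1 - ρ) (t - s) • mode ρ Λ c f s = modeInt ρ Λ c f t := by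
  have h1 := (integral_rlKernel_mul_mlKernel hρ Λ ht (sub_pos.2 hρ₁)).1
  have h3 : IntervalIntegrable (fun s => rlKernel (1 - ρ) (t - s) • causalConv (mlKernel ρ Λ) f s)
      volume 0 t := intervalIntegrable_rlKernel_smul (sub_pos.2 hρ₁) ht.le
    (continuousOn_causalConv_mlKernel hρ Λ hf hM ht)
  have h4 : ∀ s, rlKernel (1 - ρ) (t - s) • mode ρ Λ c f s
      = c * ((rlKernel (1 - ρ) (t - s) * mlKernel ρ Λ s : ℝ) : ℂ)
        + rlKernel (1 - ρ) (t - s) • causalConv (mlKernel ρ Λ) f s := fun s => by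
    simp only [mode, Complex.real_smul]
    push_cast
    ring
  simp_rw [h4]
  rw [intervalIntegral.integral_add (h1.complexOfReal.const_mul c) h3,
    intervalIntegral.integral_const_mul, integral_comp_sub_smul,
    causalConv_rlKernel_causalConv_mlKernel hρ Λ hρ₁ hf ht, modeInt,
    ← integral_rlKernel_mul_mlKernel_eq_mlRelax hρ Λ ht hρ₁, ← intervalIntegral.integral_ofReal]

/-- By positivity of the kernels, taking norms gives the same convolution with `‖c‖` and `‖f‖`, and
`r_Λ ≤ 1` removes `Λ`. The bound can therefore be summed over the modes, which permits exchanging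
sum and fractional integral. -/
theorem integral_norm_rlKernel_smul_mode_le (hρ₁ : ρ < 1) (hΛ : 0 ≤ Λ) {t : ℝ} (ht : 0 < t) :
    ∫ s in (0 : ℝ)..t, ‖rlKernel (1 - ρ) (t - s) • mode ρ Λ c f s‖
      ≤ ‖c‖ + causalConv (fun _ => 1) (fun s => ‖f s‖) t := by
  have h1 := (integral_rlKernel_mul_mlKernel hρ Λ ht (sub_pos.2 hρ₁)).1
  have h3 : IntervalIntegrable
      (fun s => rlKernel (1 - ρ) (t - s) • causalConv (mlKernel ρ Λ) (fun s => ‖f s‖) s)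
      volume 0 t := intervalIntegrable_rlKernel_smul (sub_pos.2 hρ₁) ht.le
    (continuousOn_causalConv_mlKernel hρ Λ hf.norm (M := M) (fun s => by simpa using hM s) ht)
  calc ∫ s in (0 : ℝ)..t, ‖rlKernel (1 - ρ) (t - s) • mode ρ Λ c f s‖
      ≤ ∫ s in (0 : ℝ)..t, (‖c‖ * (rlKernel (1 - ρ) (t - s) * mlKernel ρ Λ s)
          + rlKernel (1 - ρ) (t - s) • causalConv (mlKernel ρ Λ) (fun s => ‖f s‖) s) := by
        refine intervalIntegral.integral_mono_on_of_le_Ioo ht.le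
          (intervalIntegrable_rlKernel_smul_mode hρ Λ c hf hM hρ₁ ht).norm
          ((h1.const_mul _).add h3) fun s hs => ?_
        have hk := rlKernel_nonneg (sub_pos.2 hρ₁) (sub_nonneg.2 hs.2.le)
        rw [norm_smul, Real.norm_of_nonneg hk, smul_eq_mul, ← mul_assoc, mul_comm ‖c‖, mul_assoc,
          ← mul_add]
        refine mul_le_mul_of_nonneg_left ((norm_add_le _ _).trans (add_le_add ?_ ?_)) hk
        · rw [norm_mul, Complex.norm_real,
            Real.norm_of_nonneg (mlKernel_pos hρ hρ₁.le hs.1).le]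
        · refine (intervalIntegral.norm_integral_le_integral_norm hs.1.le).trans (le_of_eq ?_)
          refine intervalIntegral.integral_congr_ae (Eventually.of_forall fun ξ hξ => ?_)
          rw [uIoc_of_le hs.1.le] at hξ
          rw [norm_smul, Real.norm_of_nonneg (mlKernel_pos hρ hρ₁.le hξ.1).le, smul_eq_mul]
    _ = ‖c‖ * mlRelax ρ Λ t + causalConv (mlRelax ρ Λ) (fun s => ‖f s‖) t := by
        rw [intervalIntegral.integral_add (h1.const_mul _) h3,
          intervalIntegral.integral_const_mul, integral_comp_sub_smul,
          causalConv_rlKernel_causalConv_mlKernel hρ Λ hρ₁ hf.norm ht,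
          integral_rlKernel_mul_mlKernel_eq_mlRelax hρ Λ ht hρ₁]
    _ ≤ ‖c‖ + causalConv (fun _ => 1) (fun s => ‖f s‖) t := by
        refine add_le_add (mul_le_of_le_one_right (norm_nonneg _)
          (mlRelax_le_one hρ hρ₁.le hΛ ht)) ?_
        refine intervalIntegral.integral_mono_on_of_le_Ioo ht.le
          (intervalIntegrable_smul_comp_sub ((continuous_mlRelax hρ Λ).intervalIntegrable 0 t)
            hf.norm) (intervalIntegrable_smul_comp_sub intervalIntegrable_const hf.norm)
          fun ξ hξ => ?_
        simp only [smul_eq_mul]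
        exact mul_le_mul_of_nonneg_right (mlRelax_le_one hρ hρ₁.le hΛ hξ.1) (norm_nonneg _)

end Mode

/-! ### Fourier series on the cell `(-π, π]^N` -/

section Torus

theorem measure_pi_smul {ι : Type*} [Fintype ι] {α : ι → Type*} [∀ i, MeasurableSpace (α i)]
    (μ : ∀ i, Measure (α i)) [∀ i, IsFiniteMeasure (μ i)] (c : NNReal) :
    Measure.pi (fun i => c • μ i) = c ^ Fintype.card ι • Measure.pi μ := by
  refine Measure.pi_eq fun s _ => ?_
  simp only [Measure.smul_apply, Measure.pi_pi, ENNReal.smul_def, smul_eq_mul,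
    Finset.prod_mul_distrib, Finset.prod_const, Finset.card_univ, ENNReal.coe_pow]

/-- The Haar probability measure on the torus `(ℝ / ℤ)^N`. -/
abbrev haarTorus (N : ℕ) : Measure (UnitAddTorus (Fin N)) :=
  Measure.pi fun _ => AddCircle.haarAddCircle

/-- The covering map `x ↦ x / 2π` onto the torus `(ℝ / ℤ)^N`. -/
def cover {N : ℕ} (x : Fin N → ℝ) : UnitAddTorus (Fin N) :=
  fun j => (((2 * Real.pi)⁻¹ * x j : ℝ) : UnitAddCircle)

/-- The inverse of `cover` with values in the fundamental cell. -/
def uncover {N : ℕ} (y : UnitAddTorus (Fin N)) : Fin N → ℝ :=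
  fun j => 2 * Real.pi * (AddCircle.measurableEquivIoc 1 (-1 / 2) (y j) : ℝ)

theorem measurable_uncover {N : ℕ} : Measurable (uncover (N := N)) := by
  refine measurable_pi_lambda _ fun j => Measurable.const_mul ?_ _
  exact measurable_subtype_coe.comp
    ((AddCircle.measurableEquivIoc 1 (-1 / 2)).measurable.comp (measurable_pi_apply j))

theorem uncover_cover {N : ℕ} {x : Fin N → ℝ} (hx : x ∈ cell N) : uncover (cover x) = x := by
  ext j
  have hj := hx j (mem_univ j)
  have hpi := Real.pi_pos
  have h1 : (2 * Real.pi)⁻¹ * x j ∈ Ioc (-1 / 2 : ℝ) (-1 / 2 + 1) := by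
    constructor
    · rw [lt_inv_mul_iff₀ (by positivity)]; linarith [hj.1]
    · rw [inv_mul_le_iff₀ (by positivity)]; linarith [hj.2]
  have h2 : AddCircle.measurableEquivIoc 1 (-1 / 2) (((2 * Real.pi)⁻¹ * x j : ℝ) : UnitAddCircle)
      = ⟨_, h1⟩ := AddCircle.equivIoc_coe_eq h1
  simp only [uncover, cover]
  rw [h2]
  field_simp

/-- `2π` as a nonnegative real. -/
def twoPi : NNReal := ⟨2 * Real.pi, by positivity⟩

theorem coe_twoPi : (twoPi : ℝ) = 2 * Real.pi := rfl

theorem measurePreserving_cover_one :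
    MeasurePreserving (fun x : ℝ => (((2 * Real.pi)⁻¹ * x : ℝ) : UnitAddCircle))
      (volume.restrict (Ioc (-Real.pi) Real.pi)) (twoPi • AddCircle.haarAddCircle) := by
  have hpi := Real.pi_pos
  have h1 : MeasurePreserving (fun x : ℝ => (2 * Real.pi)⁻¹ * x) volume (twoPi • volume) := by
    refine ⟨by fun_prop, ?_⟩
    rw [Real.map_volume_mul_left (by positivity), inv_inv, abs_of_pos (by positivity)]
    ext s
    simp only [Measure.smul_apply, smul_eq_mul, ENNReal.smul_def]
    congr 1
    exact ENNReal.ofReal_eq_coe_nnreal _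
  have h2 := h1.restrict_preimage (measurableSet_Ioc (a := (-1 / 2 : ℝ)) (b := -1 / 2 + 1))
  have h3 : (fun x : ℝ => (2 * Real.pi)⁻¹ * x) ⁻¹' Ioc (-1 / 2 : ℝ) (-1 / 2 + 1)
      = Ioc (-Real.pi) Real.pi := by
    ext x
    simp only [mem_preimage, mem_Ioc, lt_inv_mul_iff₀ (by positivity : 0 < 2 * Real.pi),
      inv_mul_le_iff₀ (by positivity : 0 < 2 * Real.pi)]
    constructor <;> rintro ⟨h, h'⟩ <;> constructor <;> linarith
  rw [h3, Measure.restrict_smul] at h2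
  have h4 := (UnitAddCircle.measurePreserving_mk (-1 / 2)).smul_measure twoPi
  have h5 : (volume : Measure UnitAddCircle) = AddCircle.haarAddCircle := by
    have := AddCircle.volume_eq_smul_haarAddCircle (T := 1)
    rw [ENNReal.ofReal_one, one_smul] at this
    exact this
  rw [h5] at h4
  exact h4.comp h2

theorem measurePreserving_cover (N : ℕ) :
    MeasurePreserving (cover (N := N)) (torusMeasure N) (twoPi ^ N • haarTorus N) := by
  have h := measurePreserving_pi (fun _ : Fin N => volume.restrict (Ioc (-Real.pi) Real.pi))
    (fun _ => twoPi • AddCircle.haarAddCircle) fun _ => measurePreserving_cover_one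
  rw [measure_pi_smul, Fintype.card_fin, ← Measure.restrict_pi_pi] at h
  exact h

theorem measurePreserving_cover' (N : ℕ) :
    MeasurePreserving (cover (N := N)) ((twoPi ^ N)⁻¹ • torusMeasure N) (haarTorus N) := by
  have h := (measurePreserving_cover N).smul_measure ((twoPi ^ N)⁻¹)
  have h0 : twoPi ^ N ≠ 0 := pow_ne_zero _ (by
    rw [← NNReal.coe_ne_zero]; exact (mul_pos two_pos Real.pi_pos).ne')
  rwa [smul_smul, inv_mul_cancel₀ h0, one_smul] at h

theorem mFourier_cover {N : ℕ} (n : Fin N → ℤ) (x : Fin N → ℝ) :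
    UnitAddTorus.mFourier n (cover x) = expFun n x := by
  have hpi : (Real.pi : ℂ) ≠ 0 := by exact_mod_cast Real.pi_ne_zero
  simp only [UnitAddTorus.mFourier, ContinuousMap.coe_mk, cover, fourier_coe_apply, expFun]
  rw [← Complex.exp_sum]
  congr 1
  push_cast
  rw [Finset.mul_sum]
  refine Finset.sum_congr rfl fun j _ => ?_
  field_simp

theorem continuous_expFun {N : ℕ} (n : Fin N → ℤ) : Continuous (expFun n) := by
  unfold expFun; fun_prop

theorem norm_expFun {N : ℕ} (n : Fin N → ℤ) (x : Fin N → ℝ) : ‖expFun n x‖ = 1 := by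
  rw [expFun, mul_comm, Complex.norm_exp_ofReal_mul_I]

theorem star_expFun {N : ℕ} (n : Fin N → ℤ) (x : Fin N → ℝ) :
    (starRingEnd ℂ) (expFun n x) = expFun (-n) x := by
  rw [← mFourier_cover, ← mFourier_cover, UnitAddTorus.mFourier_neg]

theorem expFun_add {N : ℕ} (n k : Fin N → ℤ) (x : Fin N → ℝ) :
    expFun (n + k) x = expFun n x * expFun k x := by
  simp only [← mFourier_cover, UnitAddTorus.mFourier_add]

theorem isPeriodic_expFun {N : ℕ} (n : Fin N → ℤ) : IsPeriodic (expFun n) := by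
  intro j x
  rw [expFun, expFun]
  have h : Complex.I * ((∑ i, (n i : ℝ) * (x + Pi.single j (2 * Real.pi) : Fin N → ℝ) i : ℝ) : ℂ)
      = Complex.I * ((∑ i, (n i : ℝ) * x i : ℝ) : ℂ) + n j * (2 * Real.pi * Complex.I) := by
    simp only [Pi.add_apply, mul_add, Finset.sum_add_distrib, Pi.single_apply, mul_ite, mul_zero,
      Finset.sum_ite_eq', Finset.mem_univ, if_true]
    push_cast
    ring
  rw [h, Complex.exp_add, Complex.exp_int_mul_two_pi_mul_I, mul_one]

theorem integral_haarTorus_mFourier {N : ℕ} (n : Fin N → ℤ) :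
    ∫ y, UnitAddTorus.mFourier n y ∂(haarTorus N) = if n = 0 then 1 else 0 := by
  have h := (orthonormal_iff_ite.1 (UnitAddTorus.orthonormal_mFourier (d := Fin N))) 0 n
  rw [ContinuousMap.inner_toLp] at h
  simp only [UnitAddTorus.mFourier_zero, ContinuousMap.one_apply, map_one, mul_one] at h
  simp only [eq_comm (a := n)]
  exact h

theorem integral_expFun {N : ℕ} (n : Fin N → ℤ) :
    ∫ x, expFun n x ∂(torusMeasure N)
      = if n = 0 then (((2 * Real.pi) ^ N : ℝ) : ℂ) else 0 := by
  have h := integral_map (μ := torusMeasure N) (measurePreserving_cover N).measurable.aemeasurable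
    (f := UnitAddTorus.mFourier n) (UnitAddTorus.mFourier n).continuous.aestronglyMeasurable
  rw [(measurePreserving_cover N).map_eq, integral_smul_nnreal_measure,
    integral_haarTorus_mFourier] at h
  simp only [mFourier_cover] at h
  rw [← h, NNReal.smul_def, Complex.real_smul, NNReal.coe_pow]
  simp [coe_twoPi]

/-- Completeness of the exponentials, transported from the Fourier basis of `(ℝ / ℤ)^N`: `g ∘
uncover` has vanishing Fourier coefficients there, hence is null, and the covering map pulls this
back to the cell. -/
theorem ae_eq_zero_of_forall_integral_eq_zero {N : ℕ} (g : L2T N)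
    (hg : ∀ n, ∫ x, g x * expFun n x ∂(torusMeasure N) = 0) : g = 0 := by
  have hmp := measurePreserving_cover' N
  have hcell : ∀ᵐ x ∂(torusMeasure N), g (uncover (cover x)) = g x :=
    (ae_restrict_iff' (MeasurableSet.univ_pi fun _ => measurableSet_Ioc)).2
      (Eventually.of_forall fun x hx => by rw [uncover_cover hx])
  have hcell' : ∀ᵐ x ∂((twoPi ^ N)⁻¹ • torusMeasure N), g (uncover (cover x)) = g x :=
    Measure.ae_smul_measure hcell _
  set H : UnitAddTorus (Fin N) → ℂ := fun y => g (uncover y) with hH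
  have hHm : StronglyMeasurable H := (Lp.stronglyMeasurable g).comp_measurable measurable_uncover
  have hHL : MemLp H 2 (haarTorus N) := by
    refine ⟨hHm.aestronglyMeasurable, ?_⟩
    rw [← eLpNorm_comp_measurePreserving hHm.aestronglyMeasurable hmp,
      eLpNorm_congr_ae (f := H ∘ cover) (g := g) hcell']
    exact ((Lp.memLp g).smul_measure (c := (((twoPi ^ N)⁻¹ : NNReal) : ENNReal))
      ENNReal.coe_ne_top).2
  have hcoeff : ∀ n, UnitAddTorus.mFourierBasis.repr (hHL.toLp H) n = 0 := by
    intro n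
    rw [UnitAddTorus.mFourierBasis_repr]
    have h1 : UnitAddTorus.mFourierCoeff (hHL.toLp H) n
        = ∫ y, UnitAddTorus.mFourier (-n) y * H y ∂(haarTorus N) := by
      refine integral_congr_ae ?_
      filter_upwards [hHL.coeFn_toLp] with y hy
      rw [hy, smul_eq_mul]
    rw [h1, ← hmp.map_eq, integral_map hmp.measurable.aemeasurable]
    · rw [integral_smul_nnreal_measure]
      have h2 : ∫ x, UnitAddTorus.mFourier (-n) (cover x) * H (cover x) ∂(torusMeasure N)
          = ∫ x, g x * expFun (-n) x ∂(torusMeasure N) := by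
        refine integral_congr_ae ?_
        filter_upwards [hcell] with x hx
        rw [mFourier_cover, hH]
        simp only
        rw [hx, mul_comm]
      rw [h2, hg, smul_zero]
    · exact ((UnitAddTorus.mFourier (-n)).continuous.stronglyMeasurable.mul
        hHm).aestronglyMeasurable
  have hzero : hHL.toLp H = 0 := by
    refine (LinearIsometryEquiv.map_eq_zero_iff (UnitAddTorus.mFourierBasis).repr).1 ?_
    ext n
    rw [hcoeff n]
    rfl
  have hH0 : H =ᵐ[haarTorus N] 0 := by
    filter_upwards [hHL.coeFn_toLp, Lp.coeFn_zero ℂ 2 (haarTorus N)] with y hy hy'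
    rw [← hy, ← hy']
    exact congrArg (fun h : Lp ℂ 2 (haarTorus N) => h y) hzero
  have hH0' : H =ᵐ[twoPi ^ N • haarTorus N] 0 := Measure.ae_smul_measure hH0 _
  have h3 := (measurePreserving_cover N).quasiMeasurePreserving.ae hH0'
  refine Lp.ext ?_
  filter_upwards [h3, hcell, Lp.coeFn_zero ℂ 2 (torusMeasure N)] with x h4 h5 h6
  rw [h6, ← h5]
  exact h4

theorem inner_expL2 {N : ℕ} (n : Fin N → ℤ) (g : L2T N) :
    inner ℂ (expL2 n) g = ∫ x, g x * expFun (-n) x ∂(torusMeasure N) := by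
  rw [L2.inner_def]
  refine integral_congr_ae ?_
  filter_upwards [(memLp_expFun n).coeFn_toLp] with x hx
  rw [expL2, hx, RCLike.inner_apply, star_expFun]

theorem coeff_eq_inner {N : ℕ} (g : L2T N) (n : Fin N → ℤ) :
    coeff g n = (((2 * Real.pi) ^ N : ℝ) : ℂ)⁻¹ * inner ℂ (expL2 n) g := by
  rw [coeff, inner_expL2]

theorem inner_expL2_expL2 {N : ℕ} (n k : Fin N → ℤ) :
    inner ℂ (expL2 n) (expL2 k) = if n = k then (((2 * Real.pi) ^ N : ℝ) : ℂ) else 0 := by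
  rw [inner_expL2]
  have : ∫ x, (expL2 k : L2T N) x * expFun (-n) x ∂(torusMeasure N)
      = ∫ x, expFun (k - n) x ∂(torusMeasure N) := by
    refine integral_congr_ae ?_
    filter_upwards [(memLp_expFun k).coeFn_toLp] with x hx
    rw [expL2, hx, sub_eq_add_neg, expFun_add]
  rw [this, integral_expFun]
  simp only [sub_eq_zero, eq_comm]

/-- The normalization constant `(2π)^{-N/2}` of the exponentials. -/
def expNorm (N : ℕ) : ℝ := (Real.sqrt ((2 * Real.pi) ^ N))⁻¹

theorem expNorm_pos (N : ℕ) : 0 < expNorm N := by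
  unfold expNorm; positivity

theorem expNorm_mul_self (N : ℕ) : expNorm N * expNorm N = ((2 * Real.pi) ^ N)⁻¹ := by
  rw [expNorm, ← mul_inv, Real.mul_self_sqrt (by positivity)]

theorem orthonormal_expL2 (N : ℕ) :
    Orthonormal ℂ fun n : Fin N → ℤ => (expNorm N : ℂ) • (expL2 n : L2T N) := by
  rw [orthonormal_iff_ite]
  intro n k
  rw [inner_smul_left, inner_smul_right, inner_expL2_expL2, Complex.conj_ofReal]
  split_ifs
  · have := expNorm_mul_self N
    rw [← mul_assoc, ← Complex.ofReal_mul, this, ← Complex.ofReal_mul,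
      inv_mul_cancel₀ (by positivity), Complex.ofReal_one]
  · simp

/-- The normalized exponentials form a Hilbert basis of `L_2(𝕋^N)`. -/
def expBasis (N : ℕ) : HilbertBasis (Fin N → ℤ) ℂ (L2T N) :=
  HilbertBasis.mkOfOrthogonalEqBot (orthonormal_expL2 N) (by
    rw [Submodule.eq_bot_iff]
    intro g hg
    refine ae_eq_zero_of_forall_integral_eq_zero g fun n => ?_
    -- The inner product conjugates its first argument, so testing against frequency `-n` yields the
    -- integral against `e^{inx}`.
    have h := (Submodule.mem_orthogonal _ g).1 hg _
      (Submodule.subset_span ⟨-n, rfl⟩)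
    rw [inner_smul_left, inner_expL2, neg_neg, Complex.conj_ofReal, mul_eq_zero] at h
    exact h.resolve_left (by exact_mod_cast (expNorm_pos N).ne'))

theorem expBasis_apply {N : ℕ} (n : Fin N → ℤ) :
    expBasis N n = (expNorm N : ℂ) • (expL2 n : L2T N) := by
  rw [expBasis, HilbertBasis.coe_mkOfOrthogonalEqBot]

theorem coeff_eq_expBasis_repr {N : ℕ} (g : L2T N) (n : Fin N → ℤ) :
    coeff g n = (expNorm N : ℂ) * (expBasis N).repr g n := by
  rw [HilbertBasis.repr_apply_apply, expBasis_apply, inner_smul_left, coeff_eq_inner,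
    Complex.conj_ofReal, ← mul_assoc, ← Complex.ofReal_mul, expNorm_mul_self, Complex.ofReal_inv]

theorem continuous_coeff {N : ℕ} (n : Fin N → ℤ) : Continuous fun g : L2T N => coeff g n := by
  simp only [coeff_eq_inner]
  fun_prop

theorem sum_sq_coeff_le {N : ℕ} (g : L2T N) (S : Finset (Fin N → ℤ)) :
    ∑ n ∈ S, ‖coeff g n‖ ^ 2 ≤ (expNorm N * ‖g‖) ^ 2 := by
  have h := (expBasis N).orthonormal.sum_inner_products_le g (s := S)
  simp only [← HilbertBasis.repr_apply_apply] at h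
  simp only [coeff_eq_expBasis_repr, norm_mul, mul_pow, Complex.norm_real, Real.norm_eq_abs,
    sq_abs, ← Finset.mul_sum]
  exact mul_le_mul_of_nonneg_left h (sq_nonneg _)

theorem hasSum_coeff_smul_expL2 {N : ℕ} (g : L2T N) :
    HasSum (fun n => coeff g n • (expL2 n : L2T N)) g := by
  refine ((expBasis N).hasSum_repr g).congr_fun fun n => ?_
  rw [expBasis_apply, smul_smul, coeff_eq_expBasis_repr, mul_comm]

/-- Riesz–Fischer: square summability makes the `L_2` sum converge, so its coefficients can be read
off. -/
theorem coeff_tsum_smul_expL2 {N : ℕ} {a : (Fin N → ℤ) → ℂ} (ha : Summable fun n => ‖a n‖ ^ 2)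
    (n : Fin N → ℤ) : coeff (∑' k, a k • (expL2 k : L2T N)) n = a n := by
  have hne : (expNorm N : ℂ) ≠ 0 := by exact_mod_cast (expNorm_pos N).ne'
  have hmem : Memℓp (fun k => (expNorm N : ℂ)⁻¹ * a k) 2 := by
    refine memℓp_gen ?_
    simp only [norm_mul, ENNReal.toReal_ofNat, Real.rpow_ofNat, mul_pow]
    exact ha.mul_left _
  have h := (expBasis N).hasSum_repr_symm ⟨_, hmem⟩
  have h2 := h.congr_fun (g := fun k => a k • (expL2 k : L2T N)) fun k => by
    rw [expBasis_apply, smul_smul]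
    congr 1
    change a k = (expNorm N : ℂ)⁻¹ * a k * expNorm N
    field_simp
  rw [h2.tsum_eq, coeff_eq_expBasis_repr, LinearIsometryEquiv.apply_symm_apply]
  change (expNorm N : ℂ) * ((expNorm N : ℂ)⁻¹ * a n) = a n
  field_simp

/-- All exponentials have the same `L_2` norm, so the series converges absolutely in `L_2`; its
pointwise sum then agrees almost everywhere with its `L_2` sum `g`. -/
theorem ae_eq_tsum_coeff_mul_expFun {N : ℕ} (g : L2T N) (hg : Summable fun n => ‖coeff g n‖) :
    (fun x => ∑' n, coeff g n * expFun n x) =ᵐ[torusMeasure N] g := by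
  have hnorm : ∀ n : Fin N → ℤ, ‖(expL2 n : L2T N)‖ = (expNorm N)⁻¹ := fun n => by
    have h := (orthonormal_expL2 N).1 n
    rw [norm_smul, Complex.norm_real, Real.norm_of_nonneg (expNorm_pos N).le] at h
    exact eq_inv_of_mul_eq_one_right h
  have hsum : ∑' n, ‖coeff g n • (expL2 n : L2T N)‖ₑ ≠ ⊤ := by
    refine tsum_enorm_ne_top_iff_summable_norm.2 ?_
    simp only [norm_smul, hnorm]
    exact hg.mul_right _
  have h1 := Lp.coeFn_tsum hsum
  rw [(hasSum_coeff_smul_expL2 g).tsum_eq] at h1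
  have h2 : ∀ᵐ x ∂(torusMeasure N), ∀ n, (coeff g n • (expL2 n : L2T N) : L2T N) x
      = coeff g n * expFun n x := by
    refine ae_all_iff.2 fun n => ?_
    filter_upwards [Lp.coeFn_smul (coeff g n) (expL2 n : L2T N), (memLp_expFun n).coeFn_toLp]
      with x hx hx'
    rw [hx, Pi.smul_apply, expL2, hx', smul_eq_mul]
  filter_upwards [h1, h2] with x hx hx'
  rw [hx]
  simp only [hx']

end Torus

/-! ### Termwise differentiation of trigonometric series -/

theorem sum_eq_of_mem_support {N m : ℕ} {A : MvPolynomial (Fin N) ℝ} (hA : A.IsHomogeneous m)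
    {α : Fin N →₀ ℕ} (hα : α ∈ A.support) : ∑ j, α j = m := by
  rw [← hA (MvPolynomial.mem_support_iff.1 hα), ← Finsupp.degree_eq_sum,
    Finsupp.degree_eq_weight_one]
  rfl

section TrigSeries

/-- The trigonometric series `∑_n c_n e^{i n x}`. -/
def trigSeries {N : ℕ} (c : (Fin N → ℤ) → ℂ) (x : Fin N → ℝ) : ℂ := ∑' n, c n * expFun n x

/-- The coefficients `c` decay so fast that `∑_n (1 + ‖n‖)^k |c_n|` converges. -/
def WeightSummable {N : ℕ} (k : ℕ) (c : (Fin N → ℤ) → ℂ) : Prop :=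
  Summable fun n => (1 + ‖n‖) ^ k * ‖c n‖

variable {N : ℕ} {c : (Fin N → ℤ) → ℂ}

theorem WeightSummable.mono {k l : ℕ} (hc : WeightSummable l c) (hkl : k ≤ l) :
    WeightSummable k c :=
  Summable.of_nonneg_of_le (fun n => by positivity) (fun n => mul_le_mul_of_nonneg_right
    (pow_le_pow_right₀ (by linarith [norm_nonneg n]) hkl) (norm_nonneg _)) hc

theorem WeightSummable.summable {k : ℕ} (hc : WeightSummable k c) : Summable fun n => ‖c n‖ := by
  simpa [WeightSummable] using hc.mono (Nat.zero_le k)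

theorem WeightSummable.intCast_pow_mul {k l : ℕ} (hc : WeightSummable (k + l) c) (j : Fin N) :
    WeightSummable k fun n => (n j : ℂ) ^ l * c n := by
  refine Summable.of_nonneg_of_le (fun n => by positivity) (fun n => ?_) hc
  have h1 : ‖(n j : ℂ)‖ ≤ 1 + ‖n‖ := by
    have := norm_le_pi_norm n j
    rw [Complex.norm_intCast]
    rw [Int.norm_eq_abs] at this
    linarith
  rw [norm_mul, norm_pow, pow_add, mul_assoc]
  gcongr

theorem summable_norm_mul_expFun (hc : Summable fun n => ‖c n‖) (x : Fin N → ℝ) :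
    Summable fun n => ‖c n * expFun n x‖ := by
  simpa [norm_expFun] using hc

theorem isPeriodic_trigSeries (c : (Fin N → ℤ) → ℂ) : IsPeriodic (trigSeries c) := by
  intro j x
  simp only [trigSeries, isPeriodic_expFun _ j x]

theorem continuous_trigSeries (hc : Summable fun n => ‖c n‖) : Continuous (trigSeries c) :=
  continuous_tsum (fun n => continuous_const.mul (continuous_expFun n)) hc
    fun n x => by simp [norm_expFun]

/-- The `j`-th coordinate as a complex-valued real-linear map. -/
def coordCLM (j : Fin N) : (Fin N → ℝ) →L[ℝ] ℂ :=
  Complex.ofRealCLM.comp (ContinuousLinearMap.proj j)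

theorem hasFDerivAt_expFun (n : Fin N → ℤ) (x : Fin N → ℝ) :
    HasFDerivAt (expFun n) (∑ j, (Complex.I * n j * expFun n x) • coordCLM j) x := by
  have h1 : HasFDerivAt (fun y : Fin N → ℝ => Complex.I * ((∑ j, (n j : ℝ) * y j : ℝ) : ℂ))
      (∑ j, (Complex.I * n j) • coordCLM j) x := by
    have h2 : (fun y : Fin N → ℝ => Complex.I * ((∑ j, (n j : ℝ) * y j : ℝ) : ℂ))
        = fun y => (∑ j, (Complex.I * n j) • coordCLM j : (Fin N → ℝ) →L[ℝ] ℂ) y := by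
      ext y
      simp only [coordCLM, _root_.sum_apply, _root_.smul_apply,
        ContinuousLinearMap.comp_apply, ContinuousLinearMap.proj_apply, Complex.ofRealCLM_apply,
        smul_eq_mul]
      push_cast
      rw [Finset.mul_sum]
      exact Finset.sum_congr rfl fun j _ => by ring
    rw [h2]
    exact ContinuousLinearMap.hasFDerivAt _
  refine h1.cexp.congr_fderiv ?_
  rw [Finset.smul_sum]
  refine Finset.sum_congr rfl fun j _ => ?_
  rw [smul_smul, expFun]
  congr 1
  ring

theorem hasFDerivAt_trigSeries (hc : WeightSummable 1 c) (x : Fin N → ℝ) :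
    HasFDerivAt (trigSeries c)
      (∑ j, (Complex.I * trigSeries (fun n => (n j : ℂ) * c n) x) • coordCLM j) x := by
  have hcj : ∀ j, Summable fun n : Fin N → ℤ => ‖(n j : ℂ) * c n‖ := fun j => by
    have := (hc.intCast_pow_mul (k := 0) (l := 1) j).summable
    simpa using this
  have hsum : ∀ j, Summable fun n : Fin N → ℤ => (n j : ℂ) * c n * expFun n x := fun j =>
    (summable_norm_mul_expFun (hcj j) x).of_norm
  have key := hasFDerivAt_tsum (𝕜 := ℝ) (f := fun n x => c n * expFun n x)
    (f' := fun n x => ∑ j, (Complex.I * ((n j : ℂ) * c n * expFun n x)) • coordCLM j)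
    (u := fun n => ∑ j, ‖(n j : ℂ) * c n‖ * ‖coordCLM j‖) (x₀ := x)
    (summable_sum fun j _ => (hcj j).mul_right _) (fun n y => ?_) (fun n y => ?_)
    (summable_norm_mul_expFun hc.summable x).of_norm x
  · refine key.congr_fderiv ?_
    rw [Summable.tsum_finsetSum fun j _ => ((hsum j).mul_left _).smul_const _]
    refine Finset.sum_congr rfl fun j _ => ?_
    rw [((hsum j).mul_left _).tsum_smul_const, tsum_mul_left]
    rfl
  · refine ((hasFDerivAt_expFun n y).const_mul (c n)).congr_fderiv ?_
    rw [Finset.smul_sum]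
    refine Finset.sum_congr rfl fun j _ => ?_
    rw [smul_smul]
    congr 1
    ring
  · refine (norm_sum_le _ _).trans (Finset.sum_le_sum fun j _ => ?_)
    rw [norm_smul, norm_mul, norm_mul _ (expFun n y), norm_expFun, Complex.norm_I, one_mul, mul_one]

theorem contDiff_trigSeries (k : ℕ) : ∀ {c : (Fin N → ℤ) → ℂ}, WeightSummable k c →
    ContDiff ℝ k (trigSeries c) := by
  induction k with
  | zero => exact fun hc => contDiff_zero.2 (continuous_trigSeries hc.summable)
  | succ k ih =>
    intro c hc
    have hc1 : WeightSummable 1 c := hc.mono (by omega)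
    have hfd : fderiv ℝ (trigSeries c)
        = fun x => ∑ j, (Complex.I * trigSeries (fun n => (n j : ℂ) * c n) x) • coordCLM j :=
      funext fun x => (hasFDerivAt_trigSeries hc1 x).fderiv
    push_cast
    rw [contDiff_succ_iff_fderiv]
    refine ⟨fun x => (hasFDerivAt_trigSeries hc1 x).differentiableAt, by simp, ?_⟩
    rw [hfd]
    refine ContDiff.sum fun j _ => ContDiff.smul (contDiff_const.mul (ih ?_)) contDiff_const
    simpa using hc.intCast_pow_mul j

theorem partialD_trigSeries (hc : WeightSummable 1 c) (j : Fin N) :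
    partialD j (trigSeries c) = trigSeries fun n => (n j : ℂ) * c n := by
  ext x
  rw [partialD, (hasFDerivAt_trigSeries hc x).fderiv, _root_.sum_apply,
    Finset.sum_eq_single j]
  · simp only [_root_.smul_apply, coordCLM, ContinuousLinearMap.comp_apply,
      ContinuousLinearMap.proj_apply, Pi.single_eq_same, Complex.ofRealCLM_apply, smul_eq_mul,
      Complex.ofReal_one, mul_one]
    rw [← mul_assoc, neg_mul, Complex.I_mul_I, neg_neg, one_mul]
  · intro i _ hi
    simp [coordCLM, Pi.single_eq_of_ne hi]
  · simp

theorem iterate_partialD_trigSeries (j : Fin N) (k : ℕ) (hc : WeightSummable k c) :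
    (partialD j)^[k] (trigSeries c) = trigSeries fun n => (n j : ℂ) ^ k * c n := by
  induction k with
  | zero => simp
  | succ k ih =>
    rw [Function.iterate_succ_apply', ih (hc.mono (Nat.le_succ k)), partialD_trigSeries]
    · congr 1 with n
      ring
    · exact WeightSummable.intCast_pow_mul (by rwa [add_comm]) j

/-- The induction carries a spare weight `p`, because the outer derivatives still have to act on the
series left by the inner ones. -/
theorem foldr_partialD_trigSeries (α : Fin N → ℕ) (l : List (Fin N)) :
    ∀ p, WeightSummable (p + (l.map α).sum) c →
      WeightSummable p (fun n => (l.map fun j => (n j : ℂ) ^ α j).prod * c n) ∧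
      l.foldr (fun j h => (partialD j)^[α j] h) (trigSeries c)
        = trigSeries fun n => (l.map fun j => (n j : ℂ) ^ α j).prod * c n := by
  induction l with
  | nil => intro p hc; simpa using hc
  | cons j l ih =>
    intro p hc
    rw [List.map_cons, List.sum_cons, ← add_assoc] at hc
    obtain ⟨h1, h2⟩ := ih (p + α j) hc
    have h3 : (fun n : Fin N → ℤ => ((j :: l).map fun j => (n j : ℂ) ^ α j).prod * c n)
        = fun n => (n j : ℂ) ^ α j * ((l.map fun j => (n j : ℂ) ^ α j).prod * c n) := by
      ext n; rw [List.map_cons, List.prod_cons, mul_assoc]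
    rw [h3]
    refine ⟨h1.intCast_pow_mul j, ?_⟩
    rw [List.foldr_cons, h2, iterate_partialD_trigSeries j _ (h1.mono (by omega))]

theorem multiD_trigSeries {α : Fin N →₀ ℕ} (hc : WeightSummable (∑ j, α j) c) :
    WeightSummable 0 (fun n => (∏ j, (n j : ℂ) ^ α j) * c n) ∧
    multiD α (trigSeries c) = trigSeries fun n => (∏ j, (n j : ℂ) ^ α j) * c n := by
  have h := foldr_partialD_trigSeries (c := c) α (List.finRange N) 0 (by
    rwa [zero_add, ← Fin.sum_univ_def])
  simp only [← Fin.prod_univ_def] at h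
  exact h

/-- By homogeneity every monomial of `A` costs exactly the weight `m`. -/
theorem diffOp_trigSeries {A : MvPolynomial (Fin N) ℝ} {m : ℕ} (hA : A.IsHomogeneous m)
    (hc : WeightSummable m c) (x : Fin N → ℝ) :
    diffOp A (trigSeries c) x = trigSeries (fun n => (symbolAt A n : ℂ) * c n) x := by
  have hα : ∀ α ∈ A.support, WeightSummable (∑ j, α j) c := fun α h => by
    rwa [sum_eq_of_mem_support hA h]
  rw [diffOp, Finset.sum_congr rfl fun α h => by rw [(multiD_trigSeries (hα α h)).2]]
  simp only [trigSeries, ← tsum_mul_left]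
  rw [← Summable.tsum_finsetSum]
  · refine tsum_congr fun n => ?_
    rw [symbolAt, MvPolynomial.eval_eq']
    push_cast
    rw [Finset.sum_mul, Finset.sum_mul]
    exact Finset.sum_congr rfl fun α _ => by ring
  · intro α h
    exact ((summable_norm_mul_expFun (multiD_trigSeries (hα α h)).1.summable x).of_norm).mul_left _

end TrigSeries

/-! ### Elliptic symbols and the decay of coefficients -/

section Symbol

variable {N m : ℕ} {A : MvPolynomial (Fin N) ℝ}

theorem eval_smul_of_isHomogeneous (hA : A.IsHomogeneous m) (s : ℝ) (ξ : Fin N → ℝ) :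
    MvPolynomial.eval (s • ξ) A = s ^ m * MvPolynomial.eval ξ A := by
  rw [MvPolynomial.eval_eq', MvPolynomial.eval_eq', Finset.mul_sum]
  refine Finset.sum_congr rfl fun α hα => ?_
  simp only [Pi.smul_apply, smul_eq_mul, mul_pow, Finset.prod_mul_distrib]
  rw [Finset.prod_pow_eq_pow_sum, sum_eq_of_mem_support hA hα]
  ring

theorem eval_zero_of_isEllipticSymbol (hA : IsEllipticSymbol A m) : MvPolynomial.eval 0 A = 0 := by
  have := eval_smul_of_isHomogeneous hA.homogeneous 0 0
  rwa [zero_smul, zero_pow hA.order_pos.ne', zero_mul] at this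

/-- Extrema of the symbol on the compact unit sphere, extended to all `ξ` by homogeneity. -/
theorem exists_bounds_eval (hA : IsEllipticSymbol A m) :
    ∃ a C : ℝ, 0 < a ∧ 0 < C ∧ ∀ ξ, a * ‖ξ‖ ^ m ≤ MvPolynomial.eval ξ A ∧
      MvPolynomial.eval ξ A ≤ C * ‖ξ‖ ^ m := by
  have hcont : Continuous fun ξ : Fin N → ℝ => MvPolynomial.eval ξ A :=
    MvPolynomial.continuous_eval A
  have hcpt : IsCompact (Metric.sphere (0 : Fin N → ℝ) 1) := isCompact_sphere 0 1
  obtain ⟨a, C, ha, hC, h⟩ : ∃ a C : ℝ, 0 < a ∧ 0 < C ∧ ∀ ξ ∈ Metric.sphere (0 : Fin N → ℝ) 1,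
      a ≤ MvPolynomial.eval ξ A ∧ MvPolynomial.eval ξ A ≤ C := by
    -- The sphere is empty when `N = 0`, and then any constants serve.
    rcases (Metric.sphere (0 : Fin N → ℝ) 1).eq_empty_or_nonempty with he | hne
    · exact ⟨1, 1, one_pos, one_pos, fun ξ hξ => by simp [he] at hξ⟩
    · obtain ⟨ξ₁, h₁, hmin⟩ := hcpt.exists_isMinOn hne hcont.continuousOn
      obtain ⟨ξ₂, h₂, hmax⟩ := hcpt.exists_isMaxOn hne hcont.continuousOn
      have hpos : ∀ ξ ∈ Metric.sphere (0 : Fin N → ℝ) 1, 0 < MvPolynomial.eval ξ A :=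
        fun ξ hξ => hA.elliptic ξ (ne_zero_of_mem_unit_sphere ⟨ξ, hξ⟩)
      exact ⟨_, _, hpos _ h₁, hpos _ h₂, fun ξ hξ => ⟨hmin hξ, hmax hξ⟩⟩
  refine ⟨a, C, ha, hC, fun ξ => ?_⟩
  rcases eq_or_ne ξ 0 with rfl | hξ
  · rw [eval_zero_of_isEllipticSymbol hA]
    simp [hA.order_pos.ne']
  · have hn : 0 < ‖ξ‖ := norm_pos_iff.2 hξ
    have h1 := h (‖ξ‖⁻¹ • ξ) (by simp [norm_smul, hn.ne'])
    have h2 : MvPolynomial.eval ξ A = ‖ξ‖ ^ m * MvPolynomial.eval (‖ξ‖⁻¹ • ξ) A := by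
      rw [← eval_smul_of_isHomogeneous hA.homogeneous, smul_smul, mul_inv_cancel₀ hn.ne', one_smul]
    rw [h2, mul_comm a, mul_comm C]
    exact ⟨mul_le_mul_of_nonneg_left h1.1 (by positivity),
      mul_le_mul_of_nonneg_left h1.2 (by positivity)⟩

theorem norm_intCast_pi (n : Fin N → ℤ) : ‖fun j => (n j : ℝ)‖ = ‖n‖ := by
  simp only [Pi.norm_def]
  congr 2

theorem exists_bounds_symbolAt (hA : IsEllipticSymbol A m) :
    ∃ a C : ℝ, 0 < a ∧ 0 < C ∧ ∀ n : Fin N → ℤ, a * ‖n‖ ^ m ≤ symbolAt A n ∧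
      symbolAt A n ≤ C * ‖n‖ ^ m := by
  obtain ⟨a, C, ha, hC, h⟩ := exists_bounds_eval hA
  refine ⟨a, C, ha, hC, fun n => ?_⟩
  have := h fun j => (n j : ℝ)
  rwa [norm_intCast_pi] at this

theorem symbolAt_nonneg (hA : IsEllipticSymbol A m) (n : Fin N → ℤ) : 0 ≤ symbolAt A n := by
  obtain ⟨a, C, ha, hC, h⟩ := exists_bounds_symbolAt hA
  exact le_trans (by positivity) (h n).1

theorem symbolAt_pos (hA : IsEllipticSymbol A m) {n : Fin N → ℤ} (hn : n ≠ 0) :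
    0 < symbolAt A n := by
  obtain ⟨a, C, ha, hC, h⟩ := exists_bounds_symbolAt hA
  have := norm_pos_iff.2 hn
  exact lt_of_lt_of_le (by positivity) (h n).1

theorem one_le_norm_of_ne_zero {n : Fin N → ℤ} (hn : n ≠ 0) : 1 ≤ ‖n‖ := by
  obtain ⟨j, hj⟩ := Function.ne_iff.1 hn
  refine le_trans ?_ (norm_le_pi_norm n j)
  rw [Int.norm_eq_abs]
  exact_mod_cast Int.one_le_abs hj

/-- The coefficients of a function with absolutely convergent `A(D)`-series are summable with
weight `(1 + ‖n‖)^m`. -/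
theorem weightSummable_of_summable_symbolAt_mul (hA : IsEllipticSymbol A m) {c : (Fin N → ℤ) → ℂ}
    (hc : Summable fun n => ‖(symbolAt A n : ℂ) * c n‖) : WeightSummable m c := by
  obtain ⟨a, C, ha, hC, h⟩ := exists_bounds_symbolAt hA
  refine Summable.of_norm_bounded_eventually (hc.mul_left (2 ^ m * a⁻¹)) ?_
  -- The frequency `0`, where `A` vanishes, is a single term and does not affect summability.
  filter_upwards [(finite_singleton (0 : Fin N → ℤ)).compl_mem_cofinite] with n hn
  have hn1 := one_le_norm_of_ne_zero hn
  rw [Real.norm_of_nonneg (by positivity), norm_mul, Complex.norm_real,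
    Real.norm_of_nonneg (symbolAt_nonneg hA n), ← mul_assoc]
  refine mul_le_mul_of_nonneg_right ?_ (norm_nonneg _)
  calc (1 + ‖n‖) ^ m ≤ (2 * ‖n‖) ^ m := by gcongr; linarith
    _ = 2 ^ m * a⁻¹ * (a * ‖n‖ ^ m) := by rw [mul_pow]; field_simp
    _ ≤ 2 ^ m * a⁻¹ * symbolAt A n := by gcongr; exact (h n).1

/-- The integer points inject into the lattice spanned by the standard basis, whose rank is `N`. -/
theorem summable_norm_rpow_intLattice {r : ℝ} (hr : (N : ℝ) < r) :
    Summable fun n : Fin N → ℤ => ‖n‖ ^ (-r) := by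
  set b := Pi.basisFun ℝ (Fin N) with hb
  set L := Submodule.span ℤ (range b) with hL
  have hrank : Module.finrank ℤ L = N := by
    rw [ZLattice.rank ℝ L]; simp
  have hs := ZLattice.summable_norm_rpow L (-r) (by rw [hrank]; linarith)
  have hmem : ∀ n : Fin N → ℤ, (fun j => (n j : ℝ)) ∈ L := fun n => by
    have : (fun j => (n j : ℝ)) = ∑ j, n j • b j := by
      ext i
      simp [hb, Finset.sum_apply, Pi.single_apply]
    rw [this]
    exact Submodule.sum_mem _ fun j _ => Submodule.smul_mem _ _ (Submodule.subset_span ⟨j, rfl⟩)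
  have hinj : Function.Injective fun n : Fin N → ℤ => (⟨fun j => (n j : ℝ), hmem n⟩ : L) := by
    intro n k h
    ext j
    have : (n j : ℝ) = k j := congrFun (congrArg Subtype.val h) j
    exact_mod_cast this
  have := hs.comp_injective hinj
  refine this.congr fun n => ?_
  simp only [Function.comp_apply, Submodule.coe_norm]
  rw [norm_intCast_pi]

theorem summable_symbolAt_rpow (hA : IsEllipticSymbol A m) {σ : ℝ} (hσ : (N : ℝ) < 2 * (m * σ)) :
    Summable fun n : Fin N → ℤ => (symbolAt A n ^ (-σ)) ^ 2 := by
  obtain ⟨a, C, ha, hC, h⟩ := exists_bounds_symbolAt hA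
  have hm : (0 : ℝ) < m := by exact_mod_cast hA.order_pos
  have hσ0 : 0 < σ := by
    have : (0 : ℝ) < 2 * (m * σ) := lt_of_le_of_lt (Nat.cast_nonneg N) hσ
    by_contra! hneg
    nlinarith
  refine Summable.of_norm_bounded_eventually
    ((summable_norm_rpow_intLattice hσ).mul_left ((a ^ (-σ)) ^ 2)) ?_
  filter_upwards [(finite_singleton (0 : Fin N → ℤ)).compl_mem_cofinite] with n hn
  have hn0 : 0 < ‖n‖ := norm_pos_iff.2 hn
  rw [Real.norm_of_nonneg (by positivity)]
  have h1 : symbolAt A n ^ (-σ) ≤ a ^ (-σ) * ‖n‖ ^ (-(m * σ)) := by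
    refine (Real.rpow_le_rpow_of_nonpos (by positivity) (h n).1 (by linarith)).trans (le_of_eq ?_)
    rw [Real.mul_rpow ha.le (by positivity), ← Real.rpow_natCast ‖n‖ m, ← Real.rpow_mul hn0.le]
    ring_nf
  calc (symbolAt A n ^ (-σ)) ^ 2 ≤ (a ^ (-σ) * ‖n‖ ^ (-(m * σ))) ^ 2 :=
        pow_le_pow_left₀ (Real.rpow_nonneg (symbolAt_nonneg hA n) _) h1 2
    _ = (a ^ (-σ)) ^ 2 * ‖n‖ ^ (-(2 * (m * σ))) := by
        rw [mul_pow, ← Real.rpow_natCast (‖n‖ ^ _) 2, ← Real.rpow_mul hn0.le]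
        push_cast
        ring_nf

/-- The upper bound `A(n) ≤ C ‖n‖ ^ m` shows that a function in `L_2^τ` lies in the domain of this
power, so the defining series converges. -/
theorem coeff_opPow (hA : IsEllipticSymbol A m) {τ : ℝ} (hτ : 0 < τ) {g : L2T N}
    (hg : MemSobolev τ g) (n : Fin N → ℤ) :
    coeff (opPow A (τ / m) g) n = ((symbolAt A n ^ (τ / m) : ℝ) : ℂ) * coeff g n := by
  refine coeff_tsum_smul_expL2 ?_ n
  obtain ⟨a, C, ha, hC, h⟩ := exists_bounds_symbolAt hA
  have hm : (0 : ℝ) < m := by exact_mod_cast hA.order_pos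
  refine Summable.of_nonneg_of_le (fun n => by positivity) (fun n => ?_)
    (hg.mul_left ((C ^ (τ / m)) ^ 2))
  have hle : symbolAt A n ^ (τ / m) ≤ C ^ (τ / m) * ‖n‖ ^ τ := by
    refine (Real.rpow_le_rpow (symbolAt_nonneg hA n) (h n).2 (by positivity)).trans (le_of_eq ?_)
    rw [Real.mul_rpow hC.le (by positivity), ← Real.rpow_natCast ‖n‖ m,
      ← Real.rpow_mul (norm_nonneg _)]
    congr 2
    field_simp
  have hn2 : ‖n‖ ^ 2 ≤ 1 + ∑ j, (n j : ℝ) ^ 2 := by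
    have hsum : ∀ j, (n j : ℝ) ^ 2 ≤ ∑ j, (n j : ℝ) ^ 2 := fun j =>
      Finset.single_le_sum (f := fun j => (n j : ℝ) ^ 2) (fun i _ => sq_nonneg _)
        (Finset.mem_univ j)
    have h0 : (0 : ℝ) ≤ ∑ j, (n j : ℝ) ^ 2 := Finset.sum_nonneg fun i _ => sq_nonneg _
    have h1 : ‖n‖ ≤ Real.sqrt (∑ j, (n j : ℝ) ^ 2) := by
      rw [pi_norm_le_iff_of_nonneg (Real.sqrt_nonneg _)]
      intro j
      rw [Int.norm_eq_abs]
      exact Real.abs_le_sqrt (hsum j)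
    calc ‖n‖ ^ 2 ≤ Real.sqrt (∑ j, (n j : ℝ) ^ 2) ^ 2 := pow_le_pow_left₀ (norm_nonneg _) h1 2
      _ = ∑ j, (n j : ℝ) ^ 2 := Real.sq_sqrt h0
      _ ≤ _ := by linarith
  have h3 : (‖n‖ ^ τ) ^ 2 ≤ (1 + ∑ j, (n j : ℝ) ^ 2) ^ τ := by
    rw [← Real.rpow_natCast (‖n‖ ^ τ) 2, ← Real.rpow_mul (norm_nonneg _), mul_comm τ,
      Real.rpow_mul (norm_nonneg _), Real.rpow_natCast]
    exact Real.rpow_le_rpow (by positivity) hn2 hτ.le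
  rw [norm_mul, mul_pow, Complex.norm_real,
    Real.norm_of_nonneg (Real.rpow_nonneg (symbolAt_nonneg hA n) _), ← mul_assoc]
  refine mul_le_mul_of_nonneg_right ?_ (by positivity)
  calc (symbolAt A n ^ (τ / m)) ^ 2 ≤ (C ^ (τ / m) * ‖n‖ ^ τ) ^ 2 :=
        pow_le_pow_left₀ (Real.rpow_nonneg (symbolAt_nonneg hA n) _) hle 2
    _ = (C ^ (τ / m)) ^ 2 * (‖n‖ ^ τ) ^ 2 := mul_pow _ _ _
    _ ≤ _ := mul_le_mul_of_nonneg_left h3 (by positivity)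

/-- Cauchy–Schwarz on `A(n) ^ ε g_n = A(n) ^ (-(τ/m - ε)) · A(n) ^ (τ/m) g_n`. The first factor is
square summable because `2 (τ - m ε) > N`; Bessel's inequality bounds the second uniformly over `K`.
Only the first factor supplies the small tail, so it does not depend on `x`. -/
theorem unifSummableOn_coeff (hA : IsEllipticSymbol A m) {X : Type*} {K : Set X} {g : X → L2T N}
    {τ ε M : ℝ} (hτ : 0 < τ) (hε : (N : ℝ) / 2 < τ - m * ε) (hg : ∀ x ∈ K, MemSobolev τ (g x))
    (hM : ∀ x ∈ K, ‖opPow A (τ / m) (g x)‖ ≤ M) :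
    UnifSummableOn (fun n x => ((symbolAt A n ^ ε : ℝ) : ℂ) * coeff (g x) n) K := by
  classical
  intro δ hδ
  have hm : (0 : ℝ) < m := by exact_mod_cast hA.order_pos
  have hs : Summable fun n : Fin N → ℤ => (symbolAt A n ^ (-(τ / m - ε))) ^ 2 := by
    refine summable_symbolAt_rpow hA ?_
    rw [mul_sub, mul_div_cancel₀ _ hm.ne']
    linarith
  set B := expNorm N * |M| + 1 with hB
  have hBpos : 0 < B := by
    have := expNorm_pos N
    positivity
  obtain ⟨S, hS⟩ := summable_iff_vanishing_norm.1 hs ((δ / B) ^ 2) (by positivity)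
  -- The factorization fails at `n = 0`, where `A(0) = 0` erases the mean value; that single
  -- frequency is kept out of the tails.
  refine ⟨S ∪ {0}, fun T hT x hx => ?_⟩
  rw [Finset.disjoint_union_right, Finset.disjoint_singleton_right] at hT
  have h1 : ∀ n ∈ T, ‖((symbolAt A n ^ ε : ℝ) : ℂ) * coeff (g x) n‖
      = symbolAt A n ^ (-(τ / m - ε)) * ‖coeff (opPow A (τ / m) (g x)) n‖ := fun n hn => by
    have hpos := symbolAt_pos hA (n := n) fun h => hT.2 (h ▸ hn)
    rw [coeff_opPow hA hτ (hg x hx), norm_mul, norm_mul, Complex.norm_real, Complex.norm_real,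
      Real.norm_of_nonneg (by positivity), Real.norm_of_nonneg (by positivity), ← mul_assoc,
      ← Real.rpow_add hpos]
    congr 2
    ring
  rw [Finset.sum_congr rfl h1]
  refine (Real.sum_mul_le_sqrt_mul_sqrt _ _ _).trans ?_
  have h2 : Real.sqrt (∑ n ∈ T, (symbolAt A n ^ (-(τ / m - ε))) ^ 2) ≤ δ / B := by
    refine Real.sqrt_le_iff.2 ⟨by positivity, ?_⟩
    exact (Real.le_norm_self _).trans (hS T hT.1).le
  have h3 : Real.sqrt (∑ n ∈ T, ‖coeff (opPow A (τ / m) (g x)) n‖ ^ 2) ≤ B := by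
    refine Real.sqrt_le_iff.2 ⟨hBpos.le, (sum_sq_coeff_le _ T).trans ?_⟩
    refine pow_le_pow_left₀ (mul_nonneg (expNorm_pos N).le (norm_nonneg _)) ?_ 2
    have := mul_le_mul_of_nonneg_left ((hM x hx).trans (le_abs_self M)) (expNorm_pos N).le
    linarith
  calc _ ≤ δ / B * B := mul_le_mul h2 h3 (Real.sqrt_nonneg _) (by positivity)
    _ = δ := by field_simp

end Symbol

/-! ### Summing the modes -/

theorem norm_mlRelax_le_one {ρ Λ t : ℝ} (hρ : 0 < ρ) (hρ₁ : ρ ≤ 1) (hΛ : 0 ≤ Λ) (ht : 0 ≤ t) :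
    ‖mlRelax ρ Λ t‖ ≤ 1 := by
  rcases ht.eq_or_lt with rfl | ht
  · simp [mlRelax_zero hρ]
  · rw [Real.norm_of_nonneg (mlRelax_nonneg hρ hρ₁ ht)]
    exact mlRelax_le_one hρ hρ₁ hΛ ht

theorem mode_one (Λ : ℝ) (c : ℂ) (f : ℝ → ℂ) (t : ℝ) : mode 1 Λ c f t = modeInt 1 Λ c f t := by
  have h : mlKernel 1 Λ = mlRelax 1 Λ := by
    ext s
    simp [mlKernel, mlRelax]
  rw [mode, modeInt, h]

theorem fracInt_eq_integral_rlKernel_smul {ρ : ℝ} (hρ₁ : ρ < 1) (g : ℝ → ℂ) (t : ℝ) :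
    fracInt (1 - ρ) g t = ∫ s in (0 : ℝ)..t, rlKernel (1 - ρ) (t - s) • g s := by
  rw [fracInt, if_neg (sub_pos.2 hρ₁).ne', ← intervalIntegral.integral_const_mul]
  congr 1 with s
  rw [rlKernel, Complex.real_smul]
  push_cast
  ring

section Series

variable {ι : Type*} {ρ : ℝ} (hρ : 0 < ρ) (hρ₁ : ρ ≤ 1) {Λ : ι → ℝ}
  (hΛ : ∀ n, 0 ≤ Λ n) {c : ι → ℂ} (hc : Summable fun n => ‖c n‖) {f : ι → ℝ → ℂ}
  (hf : ∀ n, Continuous (f n)) (hM : ∀ n, ∃ M, ∀ s, ‖f n s‖ ≤ M) (hs : UnifSummableOn f univ)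

include hρ hρ₁ hΛ hc hf hs

theorem unifSummableOn_modeInt {T : ℝ} (hT : 0 ≤ T) :
    UnifSummableOn (fun n t => modeInt ρ (Λ n) (c n) (f n) t) (Icc 0 T) := by
  refine UnifSummableOn.add (UnifSummableOn.of_summable hc fun n t ht => ?_)
    (hs.causalConv (w := fun _ => 1) hT intervalIntegrable_const
      (fun n => (continuous_mlRelax hρ (Λ n)).intervalIntegrable 0 T) hf (fun n ξ hξ s => ?_)
      fun _ _ => zero_le_one)
  · rw [norm_mul, Complex.norm_real]
    exact mul_le_of_le_one_right (norm_nonneg _) (norm_mlRelax_le_one hρ hρ₁ (hΛ n) ht.1)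
  · exact mul_le_mul_of_nonneg_right (norm_mlRelax_le_one hρ hρ₁ (hΛ n) hξ.1.le) (norm_nonneg _)

/-- The bound `t ^ (ρ - 1) / Γ(ρ)` on the kernel may blow up as `t → 0`, so the statement is made at
a fixed positive time. -/
theorem summable_norm_mode {t : ℝ} (ht : 0 < t) :
    Summable fun n => ‖mode ρ (Λ n) (c n) (f n) t‖ := by
  have h : UnifSummableOn (fun n t => mode ρ (Λ n) (c n) (f n) t) {t} := by
    refine UnifSummableOn.add
      (UnifSummableOn.of_summable (hc.mul_right (rlKernel ρ t)) fun n s hst => ?_)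
      ((hs.causalConv (κ := fun n => mlKernel ρ (Λ n)) (f := f) (w := rlKernel ρ) (T := t) ht.le
        (intervalIntegrable_rlKernel hρ t) (fun n => intervalIntegrable_mlKernel hρ (Λ n) ht) hf
        (fun n ξ hξ s => ?_) fun ξ hξ => rlKernel_nonneg hρ hξ.1.le).mono (by simp [ht.le]))
    · rw [mem_singleton_iff.1 hst, norm_mul, Complex.norm_real,
        Real.norm_of_nonneg (mlKernel_pos hρ hρ₁ ht).le]
      exact mul_le_mul_of_nonneg_left (mlKernel_le_rlKernel hρ hρ₁ (hΛ n) ht) (norm_nonneg _)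
    · rw [abs_of_pos (mlKernel_pos hρ hρ₁ hξ.1)]
      exact mul_le_mul_of_nonneg_right (mlKernel_le_rlKernel hρ hρ₁ (hΛ n) hξ.1) (norm_nonneg _)
  exact h.summable (mem_singleton t)

-- Convergence of the `A(D) u` series for `t ≥ δ`. The initial datum uses `Λ e_Λ(t) ≤ 1 / δ`. The
-- Duhamel term splits `Λ` as `Λ ^ (1 - ε) · Λ ^ ε`, the first power going to the kernel with an
-- integrable majorant and the second to the data.
omit hs in
theorem unifSummableOn_mul_mode {ε : ℝ} (hε : 0 < ε) (hε₁ : ε < 1)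
    (hsε : UnifSummableOn (fun n s => ((Λ n ^ ε : ℝ) : ℂ) * f n s) univ) {δ T : ℝ} (hδ : 0 < δ) :
    UnifSummableOn (fun n t => (Λ n : ℂ) * mode ρ (Λ n) (c n) (f n) t) (Icc δ T) := by
  rcases lt_or_ge T δ with hlt | hδT
  · intro η _
    exact ⟨∅, fun _ _ x hx => by simp [Icc_eq_empty_of_lt hlt] at hx⟩
  have hT : 0 < T := hδ.trans_le hδT
  have h1 : UnifSummableOn (fun n t => (Λ n : ℂ) * (c n * (mlKernel ρ (Λ n) t : ℂ))) (Icc δ T) := by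
    refine UnifSummableOn.of_summable (hc.mul_right δ⁻¹) fun n t ht => ?_
    have ht0 : 0 < t := hδ.trans_le ht.1
    have hk := mlKernel_pos (Λ := Λ n) hρ hρ₁ ht0
    rw [norm_mul, norm_mul, Complex.norm_real, Complex.norm_real, Real.norm_of_nonneg (hΛ n),
      Real.norm_of_nonneg hk.le]
    have h2 : Λ n * mlKernel ρ (Λ n) t ≤ δ⁻¹ := by
      rw [← one_div, le_div_iff₀ hδ]
      refine le_trans ?_ (mul_mul_mlKernel_le_one hρ hρ₁ (hΛ n) ht0)
      rw [mul_assoc, mul_comm _ δ]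
      exact mul_le_mul_of_nonneg_left (mul_le_mul_of_nonneg_right ht.1 hk.le) (hΛ n)
    calc Λ n * (‖c n‖ * mlKernel ρ (Λ n) t) = ‖c n‖ * (Λ n * mlKernel ρ (Λ n) t) := by ring
      _ ≤ ‖c n‖ * δ⁻¹ := mul_le_mul_of_nonneg_left h2 (norm_nonneg _)
  have h3 : UnifSummableOn (fun n => causalConv (fun ξ => Λ n * mlKernel ρ (Λ n) ξ) (f n))
      (Icc 0 T) := by
    have hΓ := Real.Gamma_pos_of_pos hρ
    refine hsε.causalConv (w := fun ξ => (Real.Gamma ρ)⁻¹ ^ ε * ξ ^ (ε * ρ - 1)) hT.le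
      ((intervalIntegral.intervalIntegrable_rpow' (by
        have : 0 < ε * ρ := mul_pos hε hρ
        linarith)).const_mul _)
      (fun n => (intervalIntegrable_mlKernel hρ (Λ n) hT).const_mul _) hf (fun n ξ hξ s => ?_)
      fun ξ hξ => by have := hξ.1; positivity
    have hk := mlKernel_pos (Λ := Λ n) hρ hρ₁ hξ.1
    rw [abs_of_nonneg (mul_nonneg (hΛ n) hk.le), norm_mul, Complex.norm_real,
      Real.norm_of_nonneg (Real.rpow_nonneg (hΛ n) _), ← mul_assoc]
    refine mul_le_mul_of_nonneg_right ?_ (norm_nonneg _)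
    -- This remains valid at `Λ n = 0` because the exponents add up to `1 ≠ 0`.
    have h4 : Λ n = Λ n ^ (1 - ε) * Λ n ^ ε := by
      rw [← Real.rpow_add' (hΛ n) (by simp)]; simp
    calc Λ n * mlKernel ρ (Λ n) ξ = Λ n ^ (1 - ε) * mlKernel ρ (Λ n) ξ * Λ n ^ ε := by
          nth_rewrite 1 [h4]; ring
      _ ≤ _ := mul_le_mul_of_nonneg_right (rpow_mul_mlKernel_le hρ hρ₁ (hΛ n) hξ.1 hε hε₁)
          (Real.rpow_nonneg (hΛ n) _)
  refine (h1.add (h3.mono (Icc_subset_Icc_left hδ.le))).of_norm_le 1 id (fun _ h => h)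
    fun n t _ => le_of_eq ?_
  rw [one_mul, mode, mul_add, causalConv, causalConv, ← intervalIntegral.integral_const_mul]
  congr 3 with ξ
  simp only [Complex.real_smul, id]
  push_cast
  ring

section FractionalIntegral

variable [Countable ι] {z : ι → ℂ} (hz : ∀ n, ‖z n‖ = 1)

include hM hz

theorem intervalIntegrable_and_hasSum_integral_mode (hρ₁' : ρ < 1) {t : ℝ} (ht : 0 < t) :
    IntervalIntegrable
      (fun s => rlKernel (1 - ρ) (t - s) • ∑' n, mode ρ (Λ n) (c n) (f n) s * z n) volume 0 t ∧
    HasSum (fun n => modeInt ρ (Λ n) (c n) (f n) t * z n)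
      (∫ s in (0 : ℝ)..t, rlKernel (1 - ρ) (t - s) • ∑' n, mode ρ (Λ n) (c n) (f n) s * z n) := by
  choose M hM using hM
  have hterm : ∀ n s, rlKernel (1 - ρ) (t - s) • (mode ρ (Λ n) (c n) (f n) s * z n)
      = (rlKernel (1 - ρ) (t - s) • mode ρ (Λ n) (c n) (f n) s) * z n := fun n s => by
    rw [smul_mul_assoc]
  have hone : Summable fun n => causalConv (fun _ => 1) (fun s => ‖f n s‖) t := by
    have h := hs.causalConv (κ := fun _ _ => 1) (f := fun n s => ‖f n s‖) (w := fun _ => 1)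
      ht.le intervalIntegrable_const (fun _ => intervalIntegrable_const) (fun n => (hf n).norm)
      (fun n ξ _ s => by simp) fun _ _ => zero_le_one
    exact (h.summable ⟨ht.le, le_rfl⟩).of_norm
  have key := integrable_and_hasSum_integral (μ := volume.restrict (Ioc 0 t))
    (F := fun n s => rlKernel (1 - ρ) (t - s) • (mode ρ (Λ n) (c n) (f n) s * z n))
    (g := fun s => rlKernel (1 - ρ) (t - s) • ∑' n, mode ρ (Λ n) (c n) (f n) s * z n)
    (fun n => ?_) ?_ ?_
  · rw [intervalIntegrable_iff_integrableOn_Ioc_of_le ht.le, intervalIntegral.integral_of_le ht.le]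
    refine ⟨key.1, key.2.congr_fun fun n => ?_⟩
    simp only [hterm]
    rw [integral_mul_const, ← intervalIntegral.integral_of_le ht.le,
      integral_rlKernel_smul_mode hρ (Λ n) (c n) (hf n) (hM n) hρ₁' ht]
  · simp only [hterm]
    exact ((intervalIntegrable_iff_integrableOn_Ioc_of_le ht.le).1
      (intervalIntegrable_rlKernel_smul_mode hρ (Λ n) (c n) (hf n) (hM n) hρ₁' ht)).mul_const _
  · refine Summable.of_nonneg_of_le (fun n => integral_nonneg fun s => norm_nonneg _) (fun n => ?_)
      (hc.add hone)
    refine le_trans (le_of_eq ?_)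
      (integral_norm_rlKernel_smul_mode_le hρ (Λ n) (c n) (hf n) (hM n) hρ₁' (hΛ n) ht)
    rw [intervalIntegral.integral_of_le ht.le]
    simp only [hterm, norm_mul, hz, mul_one]
  · refine (ae_restrict_iff' measurableSet_Ioc).2 (Eventually.of_forall fun s hs' => ?_)
    refine HasSum.const_smul _ (Summable.hasSum (Summable.of_norm ?_))
    simpa [hz] using summable_norm_mode hρ hρ₁ hΛ hc hf hs hs'.1

/-- For `ρ = 1` the integral has order `0` and is the identity, and the two kernels coincide. -/
theorem fracInt_tsum_mode {t : ℝ} (ht : 0 < t) :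
    fracInt (1 - ρ) (fun s => ∑' n, mode ρ (Λ n) (c n) (f n) s * z n) t
      = ∑' n, modeInt ρ (Λ n) (c n) (f n) t * z n := by
  rcases hρ₁.lt_or_eq with h | rfl
  · rw [fracInt_eq_integral_rlKernel_smul h]
    exact (intervalIntegrable_and_hasSum_integral_mode hρ hρ₁ hΛ hc hf hM hs hz h ht).2.tsum_eq.symm
  · rw [sub_self, fracInt, if_pos rfl]
    simp only [mode_one]

-- The differentiated series converges uniformly on a neighbourhood of `t` bounded away from `0`,
-- which is where `unifSummableOn_mul_mode` applies.
omit [Countable ι] in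
theorem hasDerivAt_tsum_modeInt {ε : ℝ} (hε : 0 < ε) (hε₁ : ε < 1)
    (hsε : UnifSummableOn (fun n s => ((Λ n ^ ε : ℝ) : ℂ) * f n s) univ) {t : ℝ} (ht : 0 < t) :
    HasDerivAt (fun t => ∑' n, modeInt ρ (Λ n) (c n) (f n) t * z n)
      (∑' n, (f n t - Λ n * mode ρ (Λ n) (c n) (f n) t) * z n) t := by
  choose M hM using hM
  have hu : UnifSummableOn (fun n t => (f n t - Λ n * mode ρ (Λ n) (c n) (f n) t) * z n)
      (Icc (t / 2) (t + 1)) := by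
    refine ((hs.mono (subset_univ _)).add
      (unifSummableOn_mul_mode hρ hρ₁ hΛ hc hf hε hε₁ hsε (half_pos ht) |>.of_norm_le
        (h := fun n t => -((Λ n : ℂ) * mode ρ (Λ n) (c n) (f n) t)) 1 id (fun _ h => h)
        fun n s _ => by simp)).of_norm_le 1 id (fun _ h => h) fun n s _ => ?_
    rw [norm_mul, hz, mul_one, one_mul, sub_eq_add_neg]
    rfl
  refine hasDerivAt_of_tendstoUniformlyOn (l := atTop) (s := Ioo (t / 2) (t + 1)) isOpen_Ioo
    (hu.tendstoUniformlyOn.mono Ioo_subset_Icc_self) (Eventually.of_forall fun S s hs' => ?_)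
    (fun s hs' => ?_) ⟨by linarith, by linarith⟩ (f := fun S t => ∑ n ∈ S,
      modeInt ρ (Λ n) (c n) (f n) t * z n)
  · exact HasDerivAt.fun_sum fun n _ => (hasDerivAt_modeInt hρ (Λ n) (c n) (hf n) (hM n)
      ((half_pos ht).trans hs'.1)).mul_const _
  · have hs0 : 0 ≤ s := ((half_pos ht).trans hs'.1).le
    have := (unifSummableOn_modeInt hρ hρ₁ hΛ hc hf hs hs0).summable ⟨hs0, le_rfl⟩
    exact (Summable.of_norm (by simpa [hz] using this)).hasSum

end FractionalIntegral

end Series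

/-! ### Fourier coefficients of the data and of the solution -/

theorem mem_Icc_max_min {T : ℝ} (hT : 0 ≤ T) (t : ℝ) : max 0 (min T t) ∈ Icc 0 T :=
  ⟨le_max_left _ _, max_le hT (min_le_left _ _)⟩

theorem max_min_eq_self {T t : ℝ} (ht : t ∈ Icc 0 T) : max 0 (min T t) = t := by
  rw [min_eq_right ht.2, max_eq_right ht.1]

section Solution

variable {N m : ℕ} {A : MvPolynomial (Fin N) ℝ}

/-- The coefficients of the data, extended from `[0, T]` to the line by constants. -/
def extCoeff (T : ℝ) (f : ℝ → L2T N) (n : Fin N → ℤ) (t : ℝ) : ℂ :=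
  coeff (f (max 0 (min T t))) n

/-- The coefficients of the solution with data extended from `[0, T]` to the line. -/
def solMode (A : MvPolynomial (Fin N) ℝ) (ρ T : ℝ) (φ : L2T N) (f : ℝ → L2T N) (n : Fin N → ℤ)
    (t : ℝ) : ℂ :=
  mode ρ (symbolAt A n) (coeff φ n) (extCoeff T f n) t

theorem duhamelIntegrand_eq (A : MvPolynomial (Fin N) ℝ) (ρ : ℝ) (f : ℝ → L2T N)
    (n : Fin N → ℤ) {T t ξ : ℝ} (ht : t ≤ T) (hξ : ξ ∈ Icc 0 t) :
    duhamelIntegrand A ρ f n t ξ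
      = mlKernel ρ (symbolAt A n) ξ • extCoeff T f n (t - ξ) := by
  rw [duhamelIntegrand, extCoeff, max_min_eq_self ⟨by linarith [hξ.2], by linarith [hξ.1]⟩,
    Complex.real_smul, mul_comm, mlKernel]

theorem solCoeff_eq_solMode (A : MvPolynomial (Fin N) ℝ) (ρ : ℝ) (φ : L2T N) (f : ℝ → L2T N)
    (n : Fin N → ℤ) {T t : ℝ} (ht : t ∈ Ioc 0 T) :
    solCoeff A ρ φ f n t = solMode A ρ T φ f n t := by
  rw [solCoeff, solMode, mode, causalConv]
  congr 1
  refine intervalIntegral.integral_congr fun ξ hξ => ?_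
  rw [uIcc_of_le ht.1.le] at hξ
  exact duhamelIntegrand_eq A ρ f n ht.2 hξ

variable (hA : IsEllipticSymbol A m) {T τ : ℝ} (hT : 0 < T) (hτ : (N : ℝ) / 2 < τ)
  {f : ℝ → L2T N} (hf : ∀ t ∈ Icc 0 T, MemSobolev τ (f t))
  (hF : ContinuousOn (fun t => opPow A (τ / m) (f t)) (Icc 0 T))

include hA hT hτ hf hF

/-- For `n ≠ 0` the coefficient is recovered from that of `F(t)` on division by `A(n) ^ (τ/m)`; the
mean value needs its own hypothesis. -/
theorem continuous_extCoeff (hf₀ : ContinuousOn (fun t => coeff (f t) 0) (Icc 0 T))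
    (n : Fin N → ℤ) : Continuous (extCoeff T f n) := by
  have hτ0 : 0 < τ := lt_of_le_of_lt (by positivity) hτ
  have hclamp : Continuous fun t : ℝ => max 0 (min T t) := by fun_prop
  have h : ContinuousOn (fun t => coeff (f t) n) (Icc 0 T) := by
    rcases eq_or_ne n 0 with rfl | hn
    · exact hf₀
    · have hpos := Real.rpow_pos_of_pos (symbolAt_pos hA hn) (τ / m)
      refine ((continuousOn_const (c := ((symbolAt A n ^ (τ / m) : ℝ) : ℂ)⁻¹)).mul
        ((continuous_coeff n).comp_continuousOn hF)).congr fun t ht => ?_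
      change _ = ((symbolAt A n ^ (τ / m) : ℝ) : ℂ)⁻¹ * coeff (opPow A (τ / m) (f t)) n
      rw [coeff_opPow hA hτ0 (hf t ht), inv_mul_cancel_left₀ (by exact_mod_cast hpos.ne')]
  exact h.comp_continuous hclamp fun t => mem_Icc_max_min hT.le t

omit hA hτ hf hF in
theorem exists_norm_extCoeff_le {n : Fin N → ℤ} (hc : Continuous (extCoeff T f n)) :
    ∃ M, ∀ s, ‖extCoeff T f n s‖ ≤ M := by
  obtain ⟨M, hM⟩ := isCompact_Icc.exists_bound_of_continuousOn (s := Icc 0 T) hc.continuousOn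
  refine ⟨M, fun s => ?_⟩
  have h := hM _ (mem_Icc_max_min hT.le s)
  rwa [extCoeff, max_min_eq_self (mem_Icc_max_min hT.le s)] at h

theorem unifSummableOn_extCoeff {ε : ℝ} (hε : (N : ℝ) / 2 < τ - m * ε) :
    UnifSummableOn (fun n s => ((symbolAt A n ^ ε : ℝ) : ℂ) * extCoeff T f n s) univ := by
  have hτ0 : 0 < τ := lt_of_le_of_lt (by positivity) hτ
  obtain ⟨M, hM⟩ := isCompact_Icc.exists_bound_of_continuousOn hF
  exact unifSummableOn_coeff hA (g := fun s => f (max 0 (min T s))) hτ0 hε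
    (fun s _ => hf _ (mem_Icc_max_min hT.le s)) fun s _ => hM _ (mem_Icc_max_min hT.le s)

omit hT hf hF in
theorem summable_norm_coeff {φ : L2T N} (hφ : MemSobolev τ φ) : Summable fun n => ‖coeff φ n‖ := by
  have hτ0 : 0 < τ := lt_of_le_of_lt (by positivity) hτ
  have h := (unifSummableOn_coeff hA (K := univ) (g := fun _ : Unit => φ) (ε := 0) hτ0
    (by simpa using hτ) (fun _ _ => hφ) fun _ _ => le_rfl).summable (mem_univ ())
  simpa using h

end Solution

theorem continuousOn_of_forall_Icc {X E : Type*} [TopologicalSpace X] [TopologicalSpace E]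
    {g : X × ℝ → E} (h : ∀ δ T, 0 < δ → ContinuousOn g (univ ×ˢ Icc δ T)) :
    ContinuousOn g (univ ×ˢ Ioi 0) := by
  rintro ⟨x, t⟩ ⟨_, ht⟩
  have ht' : 0 < t := ht
  exact ((h (t / 2) (t + 1) (half_pos ht')).continuousAt
    (prod_mem_nhds univ_mem (Icc_mem_nhds (by simpa using half_lt_self ht') (by simp)))).continuousWithinAt

theorem UnifSummableOn.mul_expFun {N : ℕ} {h : (Fin N → ℤ) → ℝ → ℂ} {K : Set ℝ}
    (hh : UnifSummableOn h K) :
    UnifSummableOn (fun n (p : (Fin N → ℝ) × ℝ) => h n p.2 * expFun n p.1) (univ ×ˢ K) :=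
  hh.of_norm_le 1 Prod.snd (fun _ hp => hp.2) fun n p _ => by simp [norm_expFun]

theorem continuousOn_tsum_mul_expFun {N : ℕ} {h : (Fin N → ℤ) → ℝ → ℂ} {K : Set ℝ}
    (hh : UnifSummableOn h K) (hc : ∀ n, ContinuousOn (h n) K) :
    ContinuousOn (fun p : (Fin N → ℝ) × ℝ => ∑' n, h n p.2 * expFun n p.1) (univ ×ˢ K) :=
  hh.mul_expFun.continuousOn_tsum fun n =>
    ((hc n).comp continuousOn_snd fun _ hp => hp.2).mul
      ((continuous_expFun n).comp continuous_fst).continuousOn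

end

end TorusSubdiffusion

/-! ### The main theorem -/

open TorusSubdiffusion
theorem theorem3 {N m : ℕ} (A : MvPolynomial (Fin N) ℝ) (hA : IsEllipticSymbol A m)
    (ρ : ℝ) (hρ₀ : 0 < ρ) (hρ₁ : ρ ≤ 1) (T : ℝ) (hT : 0 < T)
    (τ : ℝ) (hτ : (N : ℝ) / 2 < τ)
    (φ : L2T N) (hφ : MemSobolev τ φ)
    (f : ℝ → L2T N) (hf : ∀ t ∈ Set.Icc 0 T, MemSobolev τ (f t))
    (hF : ContinuousOn (fun t => opPow A (τ / m) (f t)) (Set.Icc 0 T))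
    -- `A(0) = 0`, so `hF` does not see the mean value of `f(·,t)`
    (hf₀ : ContinuousOn (fun t => coeff (f t) 0) (Set.Icc 0 T)) :
    -- the continuous periodic representatives of the data
    ∃ (φc : (Fin N → ℝ) → ℂ) (fc : (Fin N → ℝ) → ℝ → ℂ) (u : (Fin N → ℝ) → ℝ → ℂ),
      (Continuous φc ∧ IsPeriodic φc ∧ φc =ᵐ[torusMeasure N] φ) ∧
      (∀ t ∈ Set.Icc 0 T, Continuous (fun x => fc x t) ∧ IsPeriodic (fun x => fc x t) ∧
        (fun x => fc x t) =ᵐ[torusMeasure N] f t) ∧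
      IsRegularSolution A m ρ T φc fc u ∧
      ∀ t ∈ Set.Ioc 0 T,
        (∀ n, IntervalIntegrable (duhamelIntegrand A ρ f n t) MeasureTheory.volume 0 t) ∧
        (∀ x, Summable fun n => ‖solCoeff A ρ φ f n t * expFun n x‖) ∧
        TendstoUniformly
          (fun (s : Finset (Fin N → ℤ)) x => ∑ n ∈ s, solCoeff A ρ φ f n t * expFun n x)
          (fun x => u x t) Filter.atTop := by
  have hm : (0 : ℝ) < m := by exact_mod_cast hA.order_pos
  -- `m ε` uses at most half of the gap `τ - N/2`; the cap `1/2` keeps `ε < 1`.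
  obtain ⟨ε, hε, hε₁, hετ⟩ : ∃ ε : ℝ, 0 < ε ∧ ε < 1 ∧ (N : ℝ) / 2 < τ - m * ε := by
    refine ⟨min (1 / 2) ((τ - N / 2) / (2 * m)), lt_min (by norm_num)
      (div_pos (by linarith) (by positivity)), (min_le_left _ _).trans_lt (by norm_num), ?_⟩
    have h := mul_le_mul_of_nonneg_left (min_le_right (1 / 2) ((τ - N / 2) / (2 * m))) hm.le
    have h2 : m * ((τ - N / 2) / (2 * m)) = (τ - N / 2) / 2 := by field_simp
    linarith
  set Λ : (Fin N → ℤ) → ℝ := symbolAt A with hΛdef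
  have hΛ : ∀ n, 0 ≤ Λ n := symbolAt_nonneg hA
  have hc : Summable fun n => ‖coeff φ n‖ := summable_norm_coeff hA hτ hφ
  set g : (Fin N → ℤ) → ℝ → ℂ := extCoeff T f with hg
  have hgc : ∀ n, Continuous (g n) := continuous_extCoeff hA hT hτ hf hF hf₀
  have hgM : ∀ n, ∃ M, ∀ s, ‖g n s‖ ≤ M := fun n => exists_norm_extCoeff_le hT (hgc n)
  have hgs : UnifSummableOn g Set.univ := by
    simpa using unifSummableOn_extCoeff hA hT hτ hf hF (ε := 0) (by simpa using hτ)
  have hgε : UnifSummableOn (fun n s => ((Λ n ^ ε : ℝ) : ℂ) * g n s) Set.univ :=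
    unifSummableOn_extCoeff hA hT hτ hf hF hετ
  set U : (Fin N → ℤ) → ℝ → ℂ := solMode A ρ T φ f with hU
  set W : (Fin N → ℤ) → ℝ → ℂ := fun n => modeInt ρ (Λ n) (coeff φ n) (g n) with hW
  have hUs : ∀ t, 0 < t → Summable fun n => ‖U n t‖ := fun t ht =>
    summable_norm_mode hρ₀ hρ₁ hΛ hc hgc hgs ht
  have hΛU : ∀ δ T', 0 < δ → UnifSummableOn (fun n t => (Λ n : ℂ) * U n t) (Set.Icc δ T') :=
    fun δ T' hδ => unifSummableOn_mul_mode hρ₀ hρ₁ hΛ hc hgc hε hε₁ hgε hδ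
  have hWs : UnifSummableOn W (Set.Icc 0 T) := unifSummableOn_modeInt hρ₀ hρ₁ hΛ hc hgc hgs hT.le
  -- Ellipticity upgrades convergence of the single series for `A(D) u` to all derivatives of order
  -- up to `m`.
  have hUw : ∀ t, 0 < t → WeightSummable m fun n => U n t := fun t ht =>
    weightSummable_of_summable_symbolAt_mul hA
      ((hΛU t t ht).summable (x := t) ⟨le_rfl, le_rfl⟩)
  have hUc : ∀ n, ContinuousOn (U n) (Set.Ioi 0) := fun n =>
    continuousOn_mode hρ₀ (Λ n) (coeff φ n) (hgc n) (hgM n).choose_spec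
  set u : (Fin N → ℝ) → ℝ → ℂ := fun x t => trigSeries (fun n => U n t) x with hu
  set fc : (Fin N → ℝ) → ℝ → ℂ := fun x t => trigSeries (fun n => g n t) x with hfc
  have hfrac : ∀ x t, 0 < t → fracInt (1 - ρ) (u x) t = ∑' n, W n t * expFun n x :=
    fun x t ht => fracInt_tsum_mode hρ₀ hρ₁ hΛ hc hgc hgM hgs (fun n => norm_expFun n x) ht
  have hdiff : ∀ x t, 0 < t → diffOp A (fun y => u y t) x = ∑' n, (Λ n : ℂ) * U n t * expFun n x :=
    fun x t ht => diffOp_trigSeries hA.homogeneous (hUw t ht) x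
  -- With the data extended past `T` by constants, the derivative is two-sided at every `t > 0`;
  -- restriction to `(0, T]` gives the left derivative at `T`.
  have hderiv : ∀ x t, 0 < t → HasDerivAt (fracInt (1 - ρ) (u x))
      (fc x t - ∑' n, (Λ n : ℂ) * U n t * expFun n x) t := fun x t ht => by
    have h := hasDerivAt_tsum_modeInt hρ₀ hρ₁ hΛ hc hgc hgM hgs (fun n => norm_expFun n x) hε hε₁
      hgε ht
    refine (h.congr_of_eventuallyEq ?_).congr_deriv ?_
    · filter_upwards [Ioi_mem_nhds ht] with s hs
      exact hfrac x s hs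
    · change _ = (∑' n, g n t * expFun n x) - _
      rw [← Summable.tsum_sub]
      · exact tsum_congr fun n => sub_mul _ _ _
      · exact (summable_norm_mul_expFun (hgs.summable (Set.mem_univ t)) x).of_norm
      · exact (summable_norm_mul_expFun ((hΛU t t ht).summable ⟨le_rfl, le_rfl⟩) x).of_norm
  have hfracD : ∀ x, ∀ t ∈ Set.Ioc 0 T, fracDeriv ρ T (u x) t
      = fc x t - ∑' n, (Λ n : ℂ) * U n t * expFun n x := fun x t ht =>
    (hderiv x t ht.1).hasDerivWithinAt.derivWithin (uniqueDiffOn_Ioc 0 T t ht)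
  have hcontΛ : ContinuousOn (fun p : (Fin N → ℝ) × ℝ => ∑' n, (Λ n : ℂ) * U n p.2 * expFun n p.1)
      (Set.univ ×ˢ Set.Ioi 0) :=
    continuousOn_of_forall_Icc fun δ T' hδ => continuousOn_tsum_mul_expFun (hΛU δ T' hδ) fun n =>
      continuousOn_const.mul ((hUc n).mono fun s hs => hδ.trans_le hs.1)
  have hcontf : ContinuousOn (fun p : (Fin N → ℝ) × ℝ => fc p.1 p.2) (Set.univ ×ˢ Set.univ) :=
    continuousOn_tsum_mul_expFun hgs fun n => (hgc n).continuousOn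
  have hcontW : ContinuousOn (fun p : (Fin N → ℝ) × ℝ => ∑' n, W n p.2 * expFun n p.1)
      (Set.univ ×ˢ Set.Icc 0 T) :=
    continuousOn_tsum_mul_expFun hWs fun n =>
      continuousOn_modeInt hρ₀ (Λ n) (coeff φ n) (hgc n) (hgM n).choose_spec hT.le
  have hsub : (Set.univ : Set (Fin N → ℝ)) ×ˢ Set.Ioc 0 T ⊆ Set.univ ×ˢ Set.Ioi 0 :=
    Set.prod_mono le_rfl fun t ht => ht.1
  have hgsum : ∀ t, Summable fun n => ‖g n t‖ := fun t => hgs.summable (Set.mem_univ t)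
  refine ⟨trigSeries (coeff φ), fc, u, ⟨continuous_trigSeries hc, isPeriodic_trigSeries _,
    ae_eq_tsum_coeff_mul_expFun φ hc⟩, fun t ht => ⟨continuous_trigSeries (hgsum t),
    isPeriodic_trigSeries _, ?_⟩, ?_, fun t ht => ⟨fun n => ?_, fun x => ?_, ?_⟩⟩
  · have hgt : ∀ n, g n t = coeff (f t) n := fun n => by rw [hg, extCoeff, max_min_eq_self ht]
    have h := ae_eq_tsum_coeff_mul_expFun (f t) (by simpa only [hgt] using hgsum t)
    simpa only [hfc, trigSeries, hgt] using h
  · refine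
      { periodic := fun t _ => isPeriodic_trigSeries _
        contDiff := fun t ht => contDiff_trigSeries m (hUw t ht.1)
        continuous_diffOp := (hcontΛ.mono hsub).congr fun p hp => hdiff p.1 p.2 hp.2.1
        integrable := fun hρ₁' x t ht => ?_
        continuous_fracInt := ⟨_, hcontW, fun x t ht => (hfrac x t ht.1).symm⟩
        differentiable := fun x t ht => (hderiv x t ht.1).differentiableAt.differentiableWithinAt
        continuous_fracDeriv :=
          ((hcontf.mono (Set.prod_mono le_rfl (Set.subset_univ _))).sub (hcontΛ.mono hsub)).congr
            fun p hp => hfracD p.1 p.2 hp.2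
        equation := fun x t ht => by rw [hfracD x t ht, hdiff x t ht.1, sub_add_cancel]
        initial := fun x => ?_ }
    · have h := (intervalIntegrable_and_hasSum_integral_mode hρ₀ hρ₁ hΛ hc hgc hgM hgs
        (fun n => norm_expFun n x) hρ₁' ht.1).1
      refine (h.const_mul ((Real.Gamma (1 - ρ) : ℝ) : ℂ)).congr fun s _ => ?_
      have hΓ : (Real.Gamma (1 - ρ) : ℂ) ≠ 0 := by
        exact_mod_cast (Real.Gamma_pos_of_pos (sub_pos.2 hρ₁')).ne'
      simp only [rlKernel, Complex.real_smul]
      push_cast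
      rw [← mul_assoc, mul_div_cancel₀ _ hΓ]
      rfl
    -- The initial condition is continuity at `t = 0` of the series for the fractional integral,
    -- since `r_Λ(0) = 1` and the convolution vanishes there.
    · have h0 : ∑' n, W n 0 * expFun n x = trigSeries (coeff φ) x := by
        simp only [hW, modeInt_zero hρ₀, trigSeries]
      have h1 : ContinuousWithinAt (fun t => ∑' n, W n t * expFun n x) (Set.Icc 0 T) 0 :=
        (hcontW.comp (f := fun t : ℝ => (x, t)) (by fun_prop) fun t ht => ⟨Set.mem_univ x, ht⟩) 0
          ⟨le_rfl, hT.le⟩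
      rw [ContinuousWithinAt, h0] at h1
      have h2 : Filter.Tendsto (fun t => ∑' n, W n t * expFun n x) (nhdsWithin 0 (Set.Ioc 0 T))
          (nhds (trigSeries (coeff φ) x)) := h1.mono_left (nhdsWithin_mono 0 Set.Ioc_subset_Icc_self)
      rw [nhdsWithin_Ioc_eq_nhdsGT hT] at h2
      exact h2.congr' (eventually_mem_nhdsWithin.mono fun t ht => (hfrac x t ht).symm)
  · refine (intervalIntegrable_smul_comp_sub (s := t)
      (intervalIntegrable_mlKernel hρ₀ (Λ n) ht.1) (hgc n)).congr fun ξ hξ => ?_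
    rw [Set.uIoc_of_le ht.1.le] at hξ
    exact (duhamelIntegrand_eq A ρ f n ht.2 ⟨hξ.1.le, hξ.2⟩).symm
  · simp only [solCoeff_eq_solMode A ρ φ f _ ht]
    exact summable_norm_mul_expFun (hUs t ht.1) x
  · simp only [solCoeff_eq_solMode A ρ φ f _ ht]
    exact tendstoUniformly_tsum (hUs t ht.1) fun n x => by
      rw [norm_mul, norm_expFun, mul_one]
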